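/- Let $\alpha,d\ge 1$ be integers and $N$ a prime. **Space.** For $a>0$ and $\mathbf h\in\mathbb Z^d$ put $\varphi_{a,d,\mathbf h}(\mathbf x)=\prod_{j=1}^d (2a)^{-1/2}\exp\bigl(2\pi i h_j\frac{x_j+a}{2a}\bigr)$, $\widehat f(\mathbf h)=\int_{[-a,a]^d}f\,\overline{\varphi_{a,d,\mathbf h}}\,d\mathbf x$ and $r_{\alpha,a,d}(\mathbf h)=\prod_{j=1}^d r_{\alpha,a}(h_j)$ with $r_{\alpha,a}(0)=\sqrt{2a}$ and $r_{\alpha,a}(h)=|\pi h/a|^\alpha$ for $h\ne0$. The scaled Korobov space $\mathcal H(K_{\alpha,a,d})$ consists of the functions $f:[-a,a]^d\to\mathbb R$ with absolutely convergent Fourier series $f=\sum_{\mathbf h}\widehat f(\mathbf h)\varphi_{a,d,\mathbf h}$ (at every point) and $\|f\|_K^2=\sum_{\mathbf h}|\widehat f(\mathbf h)|^2r_{\alpha,a,d}(\mathbf h)^2<\infty$; its inner product is $\langle f,g\rangle_K=\sum_{\mathbf h}\widehat f(\mathbf h)\overline{\widehat g(\mathbf h)}r_{\alpha,a,d}(\mathbf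 h)^2$ and its kernel is $K_{\alpha,a,d}(\mathbf x,\mathbf y)=\sum_{\mathbf h}r_{\alpha,a,d}(\mathbf h)^{-2}\varphi_{a,d,\mathbf h}(\mathbf x)\overline{\varphi_{a,d,\mathbf h}(\mathbf y)}$. **Points.** With $r=r_{\alpha,1/2,d}$ and $\mathbf z\in\{1,\dots,N-1\}^d$, let $$T_{d,s}(z_1,\dots,z_s)=\sum_{\mathbf h\in\mathbb Z^d}\ \sum_{\boldsymbol\ell}\frac{1}{r(\mathbf h)^2\,r(\mathbf h+\boldsymbol\ell)^2},$$ where $\boldsymbol\ell$ runs over the vectors of $\mathbb Z^d$ with $\boldsymbol\ell\cdot\mathbf z\equiv0\pmod N$, $\ell_s\neq0$ and $\ell_j=0$ for $j>s$. The component-by-component (CBC) construction chooses successively, for $s=1,\dots,d$, a component $z^*_s\in\{1,\dots,N-1\}$ that minimises $T_{d,s}(z_1^*,\dots,z_{s-1}^*,\,\cdot\,)$. Such a vector $\mathbf z^*$ exists. For any outcome $\mathbf z^*$ and $a\ge\frac12$ let $X^*=\{\mathbf x_1,\dots,\mathbf x_N\}$ with $\mathbf x_k=2a\{k\mathbf z^*/N\}-(a,\dots,a)$,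 where $\{\cdot\}$ is the componentwise fractional part, let $V_N=\mathrm{span}\{K_{\alpha,a,d}(\mathbf x_k,\cdot):1\le k\le N\}$, and let $P_N$ be the $\mathcal H(K_{\alpha,a,d})$-orthogonal projection onto $V_N$. **Constant.** For $0<\delta<\alpha/2$ let $$C_{\alpha,\delta,d}=\sqrt2\,\max\Bigl\{6,\,2.5+2^{\frac{2\alpha}{\alpha-2\delta}+1}\Bigr\}^{\frac\alpha2-\delta}\Bigl(\sum_{u\subseteq\{1,\dots,d\}}\max(|u|,1)\Bigl[2(2\pi)^{-\frac{\alpha}{\alpha-2\delta}}\zeta\bigl(\tfrac{\alpha}{\alpha-2\delta}\bigr)\Bigr]^{|u|}\Bigr)^{\alpha-2\delta}.$$ **Claim.** For every CBC vector $\mathbf z^*$, every $a\ge\frac12$ and every $\phi\in\mathcal H(K_{\alpha,a,d})$, the projection $P_N\phi$ is the unique element of $V_N$ that agrees with $\phi$ on $X^*$ (the kernel interpolant), and for every $\delta\in(0,\alpha/2)$ $$\|P_N\phi-\phi\|_{L^2([-a,a]^d)}\le C_{\alpha,\delta',d}\,\|\phi\|_K\,(2a)^{\alpha d}\,N^{-(\alpha/2-\delta)},\qquad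 \delta'=\min\{\delta,\tfrac\alpha2-\tfrac14\}.$$ In particular, for $0<\delta\le\frac\alpha2-\frac14$ the constant is $C_{\alpha,\delta,d}$ itself. -/

import Mathlib

noncomputable section

namespace Korobov

open MeasureTheory

/-- The box `[-a,a]^d`, with the Lebesgue measure that it inherits from `ℝ^d`. -/
abbrev Box (a : ℝ) (d : ℕ) : Type :=
  ↥(Set.Icc (fun _ : Fin d => -a) (fun _ : Fin d => a))

instance instMeasureSpaceBox (a : ℝ) (d : ℕ) : MeasureSpace (Box a d) :=
  Measure.Subtype.measureSpace

/-- `φ_{a,h}(x) = (2a)^{-1/2} exp(2πi h (x+a)/(2a))`. -/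
def trig (a : ℝ) (h : ℤ) (x : ℝ) : ℂ :=
  ((1 / Real.sqrt (2 * a) : ℝ) : ℂ) *
    Complex.exp (((2 * Real.pi * h * ((x + a) / (2 * a)) : ℝ) : ℂ) * Complex.I)

/-- `φ_{a,d,h}(x) = ∏_j φ_{a,h_j}(x_j)`. -/
def trigProd {d : ℕ} (a : ℝ) (h : Fin d → ℤ) (x : Box a d) : ℂ :=
  ∏ j, trig a (h j) (x.1 j)

/-- The Fourier coefficient `∫_{[-a,a]^d} f(x) conj(φ_{a,d,h}(x)) dx`. -/
def coeff {d : ℕ} {a : ℝ} (f : Box a d → ℝ) (h : Fin d → ℤ) : ℂ :=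
  ∫ x : Box a d, (f x : ℂ) * (starRingEnd ℂ) (trigProd a h x)

/-- `r_{α,a}(0) = √(2a)` and `r_{α,a}(h) = |πh/a|^α` for `h ≠ 0`. -/
def weight₁ (α : ℕ) (a : ℝ) (h : ℤ) : ℝ :=
  if h = 0 then Real.sqrt (2 * a) else |Real.pi * h / a| ^ α

/-- `r_{α,a,d}(h) = ∏_j r_{α,a}(h_j)`. For `a = 1/2` these are the weights of the unscaled
space on the unit cube: `1` for `h_j = 0` and `|2πh_j|^α` otherwise. -/
def weight {d : ℕ} (α : ℕ) (a : ℝ) (h : Fin d → ℤ) : ℝ :=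
  ∏ j, weight₁ α a (h j)

lemma norm_trigProd {d : ℕ} (a : ℝ) (h : Fin d → ℤ) (x : Box a d) :
    ‖trigProd a h x‖ = (1 / Real.sqrt (2 * a)) ^ d := by
  have h1 : ∀ j, ‖trig a (h j) (x.1 j)‖ = 1 / Real.sqrt (2 * a) := by
    intro j
    rw [trig, norm_mul, Complex.norm_exp_ofReal_mul_I, mul_one, Complex.norm_real,
      Real.norm_of_nonneg (by positivity)]
  simp [trigProd, norm_prod, h1]

lemma continuous_trigProd {d : ℕ} (a : ℝ) (h : Fin d → ℤ) :
    Continuous (trigProd (d := d) a h) := by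
  unfold trigProd trig
  refine continuous_finsetProd _ fun j _ => ?_
  have hj : Continuous fun x : Box a d => x.1 j := (continuous_apply j).comp continuous_subtype_val
  have h2 : Continuous fun x : Box a d => 2 * Real.pi * (h j : ℝ) * ((x.1 j + a) / (2 * a)) :=
    continuous_const.mul ((hj.add continuous_const).div_const _)
  exact continuous_const.mul (Complex.continuous_exp.comp
    ((Complex.continuous_ofReal.comp h2).mul continuous_const))

instance instIsFiniteMeasureBox (a : ℝ) (d : ℕ) :
    IsFiniteMeasure (volume : Measure (Box a d)) := by
  refine ⟨?_⟩
  rw [Measure.Subtype.volume_univ measurableSet_Icc.nullMeasurableSet]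
  exact isCompact_Icc.measure_lt_top

/-- Pointwise unconditional (that is, absolute) convergence of the Fourier series of `f` to `f`. -/
def HasFourierSeries {d : ℕ} {a : ℝ} (f : Box a d → ℝ) : Prop :=
  ∀ x, HasSum (fun h => coeff f h * trigProd a h x) (f x : ℂ)

lemma HasFourierSeries.continuous {d : ℕ} {a : ℝ} {f : Box a d → ℝ}
    (hf : HasFourierSeries f) : Continuous f := by
  rcases isEmpty_or_nonempty (Box a d) with hE | ⟨⟨x₀⟩⟩
  · exact continuous_of_const fun x => (hE.false x).elim
  have hs : Summable fun h => ‖coeff f h‖ * (1 / Real.sqrt (2 * a)) ^ d := by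
    have := (hf x₀).summable.norm
    simpa [norm_mul, norm_trigProd] using this
  have hc : Continuous fun x => ∑' h, coeff f h * trigProd a h x := by
    refine continuous_tsum (fun h => (continuous_const.mul (continuous_trigProd a h))) hs ?_
    intro h x
    rw [norm_mul, norm_trigProd]
  have : f = fun x => (∑' h, coeff f h * trigProd a h x).re := by
    funext x
    rw [(hf x).tsum_eq, Complex.ofReal_re]
  rw [this]
  exact Complex.continuous_re.comp hc

lemma integrable_coeff {d : ℕ} {a : ℝ} {f : Box a d → ℝ} (hf : Continuous f)
    (h : Fin d → ℤ) :
    Integrable fun x : Box a d => (f x : ℂ) * (starRingEnd ℂ) (trigProd a h x) := by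
  have hc : Continuous fun x : Box a d => (f x : ℂ) * (starRingEnd ℂ) (trigProd a h x) :=
    (Complex.continuous_ofReal.comp hf).mul
      (Complex.continuous_conj.comp (continuous_trigProd a h))
  obtain ⟨C, hC⟩ := (isCompact_univ.image hc).isBounded.exists_norm_le
  exact Integrable.of_bound hc.aestronglyMeasurable C
    (Filter.Eventually.of_forall fun x => hC _ ⟨x, trivial, rfl⟩)

lemma coeff_add {d : ℕ} {a : ℝ} {f g : Box a d → ℝ} (hf : Continuous f) (hg : Continuous g)
    (h : Fin d → ℤ) : coeff (f + g) h = coeff f h + coeff g h := by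
  unfold coeff
  rw [← integral_add (integrable_coeff hf h) (integrable_coeff hg h)]
  simp [add_mul]

lemma coeff_smul {d : ℕ} {a : ℝ} (c : ℝ) (f : Box a d → ℝ) (h : Fin d → ℤ) :
    coeff (c • f) h = c * coeff f h := by
  unfold coeff
  rw [← integral_const_mul]
  simp [mul_assoc]

/-- The functions `f : [-a,a]^d → ℝ` with an absolutely convergent Fourier series and
`∑_h |f̂(h)|² r_{α,a,d}(h)² < ∞`. -/
def korobovSubmodule (α : ℕ) (a : ℝ) (d : ℕ) : Submodule ℝ (Box a d → ℝ) where
  carrier := {f | HasFourierSeries f ∧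
    Summable fun h : Fin d → ℤ => ‖coeff f h‖ ^ 2 * weight α a h ^ 2}
  zero_mem' := by
    have h0 : ∀ h, coeff (0 : Box a d → ℝ) h = 0 := fun h => by simp [coeff]
    refine ⟨fun x => ?_, ?_⟩
    · simp [h0]
    · simp [h0]
  add_mem' := by
    rintro f g ⟨hf, hf2⟩ ⟨hg, hg2⟩
    have hadd := coeff_add hf.continuous hg.continuous
    refine ⟨fun x => ?_, ?_⟩
    · simpa [hadd, add_mul] using (hf x).add (hg x)
    · refine Summable.of_nonneg_of_le (fun h => by positivity) (fun h => ?_)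
        ((hf2.add hg2).mul_left 2)
      rw [hadd]
      have h1 := norm_add_le (coeff f h) (coeff g h)
      have h2 : ‖coeff f h + coeff g h‖ ^ 2 ≤ 2 * (‖coeff f h‖ ^ 2 + ‖coeff g h‖ ^ 2) := by
        nlinarith [norm_nonneg (coeff f h + coeff g h), sq_nonneg (‖coeff f h‖ - ‖coeff g h‖)]
      nlinarith [mul_le_mul_of_nonneg_right h2 (sq_nonneg (weight α a h))]
  smul_mem' := by
    rintro c f ⟨hf, hf2⟩
    refine ⟨fun x => ?_, ?_⟩
    · simpa [coeff_smul, mul_assoc] using (hf x).mul_left (c : ℂ)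
    · simpa [coeff_smul, mul_pow, mul_assoc] using hf2.mul_left (c ^ 2)

/-- The scaled Korobov space `H(K_{α,a,d})`. It is kept apart from the subtype of
`korobovSubmodule`, whose topology would be that of pointwise convergence. -/
def KorobovSpace (α : ℕ) (a : ℝ) (d : ℕ) : Type := ↥(korobovSubmodule α a d)

instance instAddCommGroup (α : ℕ) (a : ℝ) (d : ℕ) : AddCommGroup (KorobovSpace α a d) :=
  inferInstanceAs (AddCommGroup ↥(korobovSubmodule α a d))

instance instModule (α : ℕ) (a : ℝ) (d : ℕ) : Module ℝ (KorobovSpace α a d) :=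
  inferInstanceAs (Module ℝ ↥(korobovSubmodule α a d))

/-- Elements of the Korobov space, as functions on the box. -/
def toFun {α : ℕ} {a : ℝ} {d : ℕ} : KorobovSpace α a d →ₗ[ℝ] (Box a d → ℝ) :=
  (korobovSubmodule α a d).subtype

instance instCoeFun (α : ℕ) (a : ℝ) (d : ℕ) :
    CoeFun (KorobovSpace α a d) fun _ => Box a d → ℝ := ⟨fun f => toFun f⟩

lemma toFun_injective {α : ℕ} {a : ℝ} {d : ℕ} :
    Function.Injective (toFun : KorobovSpace α a d →ₗ[ℝ] (Box a d → ℝ)) :=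
  Subtype.val_injective

/-- `⟨f, g⟩ = ∑_h f̂(h) conj(ĝ(h)) r_{α,a,d}(h)²`. The sum is a real number, because `f` and `g`
are real-valued. -/
def innerK {α : ℕ} {a : ℝ} {d : ℕ} (f g : KorobovSpace α a d) : ℝ :=
  (∑' h : Fin d → ℤ, coeff f h * (starRingEnd ℂ) (coeff g h) * ((weight α a h ^ 2 : ℝ) : ℂ)).re

lemma summable_innerK {α : ℕ} {a : ℝ} {d : ℕ} (f g : KorobovSpace α a d) :
    Summable fun h : Fin d → ℤ =>
      coeff f h * (starRingEnd ℂ) (coeff g h) * ((weight α a h ^ 2 : ℝ) : ℂ) := by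
  refine Summable.of_norm_bounded (f.2.2.add g.2.2) (fun h => ?_)
  rw [norm_mul, norm_mul, RCLike.norm_conj, Complex.norm_real, Real.norm_of_nonneg (sq_nonneg _)]
  change ‖coeff f.1 h‖ * ‖coeff g.1 h‖ * weight α a h ^ 2 ≤ _
  have h2 : ‖coeff f.1 h‖ * ‖coeff g.1 h‖ ≤ ‖coeff f.1 h‖ ^ 2 + ‖coeff g.1 h‖ ^ 2 := by
    nlinarith [sq_nonneg (‖coeff f.1 h‖ - ‖coeff g.1 h‖), sq_nonneg (‖coeff f.1 h‖),
      sq_nonneg (‖coeff g.1 h‖)]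
  nlinarith [mul_le_mul_of_nonneg_right h2 (sq_nonneg (weight α a h))]

lemma innerK_self {α : ℕ} {a : ℝ} {d : ℕ} (f : KorobovSpace α a d) :
    innerK f f = ∑' h : Fin d → ℤ, ‖coeff f h‖ ^ 2 * weight α a h ^ 2 := by
  unfold innerK
  rw [← Complex.ofReal_re (∑' h : Fin d → ℤ, ‖coeff f h‖ ^ 2 * weight α a h ^ 2),
    Complex.ofReal_tsum]
  congr 2
  funext h
  rw [Complex.mul_conj, Complex.normSq_eq_norm_sq]
  push_cast
  rfl

lemma weight_ne_zero {d : ℕ} (α : ℕ) {a : ℝ} (h : Fin d → ℤ) (x : Box a d)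
    (hx : trigProd a h x ≠ 0) : weight α a h ≠ 0 := by
  refine Finset.prod_ne_zero_iff.2 fun j _ => ?_
  have hj : trig a (h j) (x.1 j) ≠ 0 := Finset.prod_ne_zero_iff.1 hx j (Finset.mem_univ j)
  have hs : Real.sqrt (2 * a) ≠ 0 := by
    intro hs
    exact hj (by simp [trig, hs])
  unfold weight₁
  split_ifs with h0
  · exact hs
  · have ha : a ≠ 0 := by
      rintro rfl
      simp at hs
    have : (h j : ℝ) ≠ 0 := by exact_mod_cast h0
    have hpi := Real.pi_ne_zero
    positivity

/-- The inner product axioms for `innerK`. -/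
@[reducible]
def core (α : ℕ) (a : ℝ) (d : ℕ) : InnerProductSpace.Core ℝ (KorobovSpace α a d) where
  inner := innerK
  conj_inner_symm f g := by
    simp only [conj_trivial]
    unfold innerK
    rw [← Complex.conj_re, Complex.conj_tsum]
    congr 2
    funext h
    simp [mul_comm]
  re_inner_nonneg f := by
    change 0 ≤ innerK f f
    rw [innerK_self]
    exact tsum_nonneg fun h => by positivity
  add_left f g k := by
    unfold innerK
    rw [← Complex.add_re, ← (summable_innerK f k).tsum_add (summable_innerK g k)]
    congr 2
    funext h
    have hfg : coeff (toFun f + toFun g) h = coeff (toFun f) h + coeff (toFun g) h :=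
      coeff_add f.2.1.continuous g.2.1.continuous h
    rw [map_add, hfg]
    ring
  smul_left f g c := by
    unfold innerK
    rw [conj_trivial, ← Complex.re_ofReal_mul, ← tsum_mul_left]
    congr 2
    funext h
    rw [map_smul, coeff_smul]
    ring
  definite f hf := by
    change innerK f f = 0 at hf
    rw [innerK_self] at hf
    have h0 := (hasSum_zero_iff_of_nonneg (fun h => by positivity)).1 (hf ▸ f.2.2.hasSum)
    refine toFun_injective (funext fun x => ?_)
    have hz : ∀ h, coeff f.1 h * trigProd a h x = 0 := by
      intro h
      by_cases hx : trigProd a h x = 0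
      · rw [hx, mul_zero]
      · have := congrFun h0 h
        simp only [Pi.zero_apply, mul_eq_zero, pow_eq_zero_iff (two_ne_zero), norm_eq_zero] at this
        rcases this with h1 | h1
        · rw [h1, zero_mul]
        · exact absurd h1 (weight_ne_zero α h x hx)
    have hs := f.2.1 x
    simp only [hz] at hs
    exact Complex.ofReal_eq_zero.1 (hs.unique hasSum_zero)

instance instNormedAddCommGroup (α : ℕ) (a : ℝ) (d : ℕ) :
    NormedAddCommGroup (KorobovSpace α a d) :=
  (core α a d).toNormedAddCommGroup

instance instInnerProductSpace (α : ℕ) (a : ℝ) (d : ℕ) :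
    InnerProductSpace ℝ (KorobovSpace α a d) :=
  InnerProductSpace.ofCore (core α a d).toCore

/-- The kernel `K_{α,a,d}(x,y) = ∑_h r_{α,a,d}(h)^{-2} φ_{a,d,h}(x) conj(φ_{a,d,h}(y))`. The sum
is a real number, because the terms at `h` and `-h` are conjugate. -/
def kernel {d : ℕ} (α : ℕ) (a : ℝ) (x y : Box a d) : ℝ :=
  (∑' h : Fin d → ℤ, (((weight α a h ^ 2)⁻¹ : ℝ) : ℂ) * trigProd a h x *
    (starRingEnd ℂ) (trigProd a h y)).re

/-- `V_N(X) = span {K(x_k, ·)}`, as a subspace of the Korobov space. -/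
def kernelSpan {ι : Type*} {d : ℕ} (α : ℕ) {a : ℝ} (X : ι → Box a d) :
    Submodule ℝ (KorobovSpace α a d) :=
  (Submodule.span ℝ (Set.range fun k => kernel α a (X k))).comap toFun

instance instFiniteDimensionalKernelSpan {ι : Type*} [Finite ι] {d : ℕ} (α : ℕ) {a : ℝ}
    (X : ι → Box a d) : FiniteDimensional ℝ (kernelSpan α X) := by
  have : FiniteDimensional ℝ (Submodule.span ℝ (Set.range fun k => kernel α a (X k))) :=
    FiniteDimensional.span_of_finite ℝ (Set.finite_range _)
  let T : kernelSpan α X →ₗ[ℝ] Submodule.span ℝ (Set.range fun k => kernel α a (X k)) :=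
    (toFun.comp (kernelSpan α X).subtype).codRestrict _ fun v => v.2
  refine FiniteDimensional.of_injective T fun u v huv => ?_
  have h : toFun u.1 = toFun v.1 := congrArg (fun w => w.1) huv
  exact Subtype.ext (toFun_injective h)

/-- The `H(K_{α,a,d})`-orthogonal projection `P_N` onto `V_N(X)`. -/
def proj {ι : Type*} [Finite ι] {d : ℕ} (α : ℕ) {a : ℝ} (X : ι → Box a d)
    (φ : KorobovSpace α a d) : KorobovSpace α a d :=
  (kernelSpan α X).starProjection φ

/-- The summand `T_{d,s}(z_1,…,z_s)` of the criterion
`S_d(z) = ∑_{h ∈ ℤ^d} ∑_{0 ≠ ℓ ∈ ℤ^d, ℓ·z ≡ 0 (mod N)} r(h)^{-2} r(h+ℓ)^{-2}`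
(weights of the unit cube) in its dimension-wise decomposition `S_d = ∑_s T_{d,s}`: it collects
the `ℓ` whose last nonzero component is the one with index `s`, hence depends on `z` only through
the components up to `s`. -/
def cbcCriterion {d : ℕ} (α N : ℕ) (s : Fin d) (z : Fin d → ℕ) : ℝ :=
  open Classical in
  ∑' p : (Fin d → ℤ) × (Fin d → ℤ),
    if p.2 s ≠ 0 ∧ (∀ j, s < j → p.2 j = 0) ∧ (N : ℤ) ∣ ∑ j, p.2 j * (z j : ℤ) then
      (weight α (1 / 2) p.1 ^ 2 * weight α (1 / 2) (p.1 + p.2) ^ 2)⁻¹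
    else 0

/-- `z` is an outcome of the component-by-component construction with `N` points: successively for
`s = 1, …, d`, with the earlier components held fixed, `z_s ∈ {1, …, N-1}` is chosen so as to
minimise `T_{d,s}(z_1,…,z_s)`. -/
def IsCBCVector {d : ℕ} (α N : ℕ) (z : Fin d → ℕ) : Prop :=
  ∀ s : Fin d, (1 ≤ z s ∧ z s < N) ∧
    ∀ c : ℕ, 1 ≤ c → c < N → cbcCriterion α N s z ≤ cbcCriterion α N s (Function.update z s c)

/-- The points `J_a({k z / N}) = 2a {k z / N} - a` of the scaled lattice; the index `k : Fin N`
stands for `k + 1 ∈ {1, …, N}`. -/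
def scaledLattice {d : ℕ} (a : ℝ) (ha : 0 ≤ a) (N : ℕ) (z : Fin d → ℕ) (k : Fin N) : Box a d :=
  ⟨fun j => 2 * a * Int.fract ((((k : ℕ) : ℝ) + 1) * (z j : ℝ) / (N : ℝ)) - a, by
    constructor <;> intro j
    · have := mul_nonneg ha (Int.fract_nonneg ((((k : ℕ) : ℝ) + 1) * (z j : ℝ) / (N : ℝ)))
      simp only
      linarith
    · have := mul_le_mul_of_nonneg_left
        (Int.fract_lt_one ((((k : ℕ) : ℝ) + 1) * (z j : ℝ) / (N : ℝ))).le ha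
      simp only
      linarith⟩

/-- `ζ(s) = ∑_{n ≥ 1} n^{-s}` for real `s > 1`. -/
def zeta (s : ℝ) : ℝ := ∑' n : ℕ, ((n : ℝ) + 1) ^ (-s)

/-- `κ_{α,δ} = √2 max{6, 2.5 + 2^{2α/(α-2δ)+1}}^{α/2-δ}`. -/
def kappa (α : ℕ) (δ : ℝ) : ℝ :=
  Real.sqrt 2 *
    (max 6 (5 / 2 + (2 : ℝ) ^ (2 * (α : ℝ) / ((α : ℝ) - 2 * δ) + 1))) ^ ((α : ℝ) / 2 - δ)

/-- `C_{α,δ,d} = κ_{α,δ} (∑_{u ⊆ {1:d}} max(|u|,1)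
[2 (2π)^{-α/(α-2δ)} ζ(α/(α-2δ))]^{|u|})^{α-2δ}`. -/
def errorConst (α : ℕ) (δ : ℝ) (d : ℕ) : ℝ :=
  kappa α δ *
    (∑ u : Finset (Fin d), ((max u.card 1 : ℕ) : ℝ) *
      (2 * (1 / (2 * Real.pi)) ^ ((α : ℝ) / ((α : ℝ) - 2 * δ)) *
        zeta ((α : ℝ) / ((α : ℝ) - 2 * δ))) ^ u.card) ^ ((α : ℝ) - 2 * δ)

end Korobov

end

/-!
By the reproducing property, `V_N^⊥` consists of the functions vanishing at the points, so the
projection interpolates and the error `g = φ - P_N φ` vanishes on the lattice. Summing its Fourier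
series over the lattice points, the coefficients of `g` sum to zero over every coset of the dual
lattice `L`. Hence `|ĝ(h)| ≤ ∑_{0 ≠ l ∈ L} |ĝ(h + l)|`; multiplying by `|ĝ(h)|`, summing over `h`
and applying Cauchy-Schwarz to the sum over the pairs `(h, l)`, we get
`(∑_h |ĝ(h)|²)² ≤ (∑_h |ĝ(h)|² r(h)²)² S(z)` with `S(z) = ∑_s T_{d,s}(z)`.

For `0 < q ≤ 1`, a minimising component makes `T_{d,s}(z)^q` at most the average of
`T_{d,s}(z_1, …, z_{s-1}, c)^q` over `c`, and `(∑ t)^q ≤ ∑ t^q` moves the power to the summands. As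
`N` is prime, an `l` with `N ∤ l_s` lies in the dual lattice for at most one `c`, while those with
`N ∣ l_s` are sparse. So `S(z)^q = O(1 / N)` as long as `2αq > 1`; take `q = 1 / (2(α - 2δ))`.
-/

noncomputable section

namespace Korobov

open MeasureTheory
open scoped ENNReal ComplexConjugate

/-! ### Sums in `ℝ≥0∞` -/

lemma tsum_pi_prod {β : Type*} : ∀ {d : ℕ} (F : Fin d → β → ℝ≥0∞),
    ∑' h : Fin d → β, ∏ j, F j (h j) = ∏ j, ∑' b, F j b
  | 0, F => by simp [tsum_fintype]
  | d + 1, F => by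
    rw [← (Fin.consEquiv fun _ => β).tsum_eq, ENNReal.tsum_prod', Fin.prod_univ_succ,
      ← tsum_pi_prod fun j => F j.succ, ← ENNReal.tsum_mul_right]
    refine tsum_congr fun b => ?_
    rw [← ENNReal.tsum_mul_left]
    exact tsum_congr fun h => by simp [Fin.prod_univ_succ, Fin.consEquiv]

lemma rpow_sum_le_sum_rpow {ι : Type*} (s : Finset ι) (f : ι → ℝ≥0∞) {p : ℝ} (hp : 0 < p)
    (hp1 : p ≤ 1) : (∑ i ∈ s, f i) ^ p ≤ ∑ i ∈ s, f i ^ p := by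
  classical
  induction s using Finset.induction_on with
  | empty => simp [hp]
  | insert i s hi ih =>
    rw [Finset.sum_insert hi, Finset.sum_insert hi]
    exact (ENNReal.rpow_add_le_add_rpow _ _ hp.le hp1).trans (by gcongr)

lemma rpow_tsum_le_tsum_rpow {ι : Type*} (f : ι → ℝ≥0∞) {p : ℝ} (hp : 0 < p) (hp1 : p ≤ 1) :
    (∑' i, f i) ^ p ≤ ∑' i, f i ^ p := by
  rw [← ENNReal.le_rpow_inv_iff hp, ENNReal.tsum_eq_iSup_sum]
  refine iSup_le fun s => (ENNReal.le_rpow_inv_iff hp).2 ?_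
  exact (rpow_sum_le_sum_rpow s f hp hp1).trans (ENNReal.sum_le_tsum s)

lemma sq_tsum_mul_le {ι : Type*} (f g : ι → ℝ≥0∞) :
    (∑' i, f i * g i) ^ 2 ≤ (∑' i, f i ^ 2) * ∑' i, g i ^ 2 := by
  let _ : MeasurableSpace ι := ⊤
  have h := ENNReal.lintegral_mul_le_Lp_mul_Lq Measure.count Real.HolderConjugate.two_two
    (f := f) (g := g) measurable_from_top.aemeasurable measurable_from_top.aemeasurable
  simp only [Pi.mul_apply, lintegral_count, ENNReal.rpow_ofNat] at h
  calc (∑' i, f i * g i) ^ 2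
      ≤ ((∑' i, f i ^ 2) ^ (1 / 2 : ℝ) * (∑' i, g i ^ 2) ^ (1 / 2 : ℝ)) ^ 2 := by gcongr
    _ = (∑' i, f i ^ 2) * ∑' i, g i ^ 2 := by
        simp [mul_pow, ← ENNReal.rpow_mul_natCast]

lemma sq_tsum_le_tsum_sq_div_mul {ι : Type*} (f : ι → ℝ≥0∞) {u : ι → ℝ≥0∞}
    (hu0 : ∀ i, u i ≠ 0) (hu : ∀ i, u i ≠ ∞) :
    (∑' i, f i) ^ 2 ≤ (∑' i, f i ^ 2 / u i) * ∑' i, u i := by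
  let root (i : ι) : ℝ≥0∞ := u i ^ (1 / 2 : ℝ)
  have hroot (i : ι) : root i ^ 2 = u i := by simp [root, ← ENNReal.rpow_mul_natCast]
  have hroot0 (i : ι) : root i ≠ 0 := fun h => hu0 i (by rw [← hroot, h, zero_pow two_ne_zero])
  have hroot_top (i : ι) : root i ≠ ∞ := ENNReal.rpow_ne_top_of_nonneg (by norm_num) (hu i)
  calc (∑' i, f i) ^ 2 = (∑' i, f i / root i * root i) ^ 2 := by
        simp only [ENNReal.div_mul_cancel (hroot0 _) (hroot_top _)]
    _ ≤ (∑' i, (f i / root i) ^ 2) * ∑' i, root i ^ 2 := sq_tsum_mul_le _ _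
    _ = (∑' i, f i ^ 2 / u i) * ∑' i, u i := by
        simp only [div_eq_mul_inv, mul_pow, ← ENNReal.inv_pow, hroot]

/-! ### Autocorrelations -/

/-- The autocorrelation `∑_h u(h) u(h + l)` of a weight `u` on an additive group. -/
def autocorr {G : Type*} [Add G] (u : G → ℝ≥0∞) (l : G) : ℝ≥0∞ := ∑' h, u h * u (h + l)

lemma tsum_autocorr {G : Type*} [AddGroup G] (u : G → ℝ≥0∞) :
    ∑' l, autocorr u l = (∑' h, u h) ^ 2 := by
  unfold autocorr
  rw [ENNReal.tsum_comm, sq, ← ENNReal.tsum_mul_right]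
  refine tsum_congr fun h => ?_
  rw [ENNReal.tsum_mul_left]
  exact congrArg (u h * ·) ((Equiv.addLeft h).tsum_eq u)

lemma sq_tsum_sq_le_mul_tsum_autocorr {G : Type*} [AddGroup G] {c u : G → ℝ≥0∞} {D : Set G}
    (hu0 : ∀ h, u h ≠ 0) (hu : ∀ h, u h ≠ ∞) (hc : ∀ h, c h ≤ ∑' l : D, c (h + l)) :
    (∑' h, c h ^ 2) ^ 2 ≤ (∑' h, c h ^ 2 / u h) ^ 2 * ∑' l : D, autocorr u l := by
  have hswap (v : G → ℝ≥0∞) :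
      ∑' p : G × D, v p.1 * v (p.1 + p.2) = ∑' l : D, autocorr v l := by
    rw [ENNReal.tsum_prod', ENNReal.tsum_comm]
    rfl
  calc (∑' h, c h ^ 2) ^ 2 ≤ (∑' p : G × D, c p.1 * c (p.1 + p.2)) ^ 2 := by
        simp only [ENNReal.tsum_prod', ENNReal.tsum_mul_left, sq (c _)]
        gcongr
        exact hc _
    _ ≤ (∑' p : G × D, (c p.1 * c (p.1 + p.2)) ^ 2 / (u p.1 * u (p.1 + p.2))) *
          ∑' p : G × D, u p.1 * u (p.1 + p.2) :=
        sq_tsum_le_tsum_sq_div_mul _ (fun p => mul_ne_zero (hu0 _) (hu0 _))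
          fun p => ENNReal.mul_ne_top (hu _) (hu _)
    _ = (∑' l : D, autocorr (fun h => c h ^ 2 / u h) l) * ∑' l : D, autocorr u l := by
        rw [← hswap, ← hswap]
        simp only [mul_pow, ENNReal.mul_div_mul_comm (Or.inl (hu0 _)) (Or.inl (hu _))]
    _ ≤ (∑' h, c h ^ 2 / u h) ^ 2 * ∑' l : D, autocorr u l := by
        rw [← tsum_autocorr]
        gcongr
        exact ENNReal.tsum_comp_le_tsum_of_injective Subtype.val_injective _

lemma autocorr_rpow_le {G : Type*} [Add G] (u : G → ℝ≥0∞) (l : G) {p : ℝ} (hp : 0 < p)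
    (hp1 : p ≤ 1) : autocorr u l ^ p ≤ autocorr (fun h => u h ^ p) l := by
  refine (rpow_tsum_le_tsum_rpow _ hp hp1).trans_eq (tsum_congr fun h => ?_)
  exact ENNReal.mul_rpow_of_nonneg _ _ hp.le

lemma autocorr_prod {β : Type*} [Add β] {d : ℕ} (u : β → ℝ≥0∞) (l : Fin d → β) :
    autocorr (fun h : Fin d → β => ∏ j, u (h j)) l = ∏ j, autocorr u (l j) := by
  simp only [autocorr, Pi.add_apply, ← Finset.prod_mul_distrib]
  exact tsum_pi_prod fun j h => u h * u (h + l j)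

/-! ### Polynomially decaying weights on the integers -/

/-- The weight `1` at `0` and `(2π|h|)^{-b}` elsewhere. For `b = 2α` it is the inverse square of
the one-dimensional weight of the unscaled Korobov space. -/
def decay (b : ℝ) (h : ℤ) : ℝ≥0∞ :=
  if h = 0 then 1 else ENNReal.ofReal ((2 * Real.pi * |(h : ℝ)|) ^ (-b))

/-- The sum of `decay b` over the nonzero integers, that is, `2 (2π)^{-b} ζ(b)` for `b > 1`. -/
def nonzeroMass (b : ℝ) : ℝ≥0∞ := ∑' h : ({0}ᶜ : Set ℤ), decay b h

@[simp]
lemma decay_zero (b : ℝ) : decay b 0 = 1 := if_pos rfl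

lemma decay_of_ne_zero (b : ℝ) {h : ℤ} (hh : h ≠ 0) :
    decay b h = ENNReal.ofReal ((2 * Real.pi * |(h : ℝ)|) ^ (-b)) := if_neg hh

@[simp]
lemma decay_neg (b : ℝ) (h : ℤ) : decay b (-h) = decay b h := by simp [decay]

lemma decay_rpow (b p : ℝ) (h : ℤ) : decay b h ^ p = decay (b * p) h := by
  rcases eq_or_ne h 0 with rfl | hh
  · simp
  · have hpos : 0 < 2 * Real.pi * |(h : ℝ)| := by positivity
    rw [decay_of_ne_zero b hh, decay_of_ne_zero _ hh,
      ENNReal.ofReal_rpow_of_pos (Real.rpow_pos_of_pos hpos _), ← Real.rpow_mul hpos.le, neg_mul]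

lemma tsum_decay (b : ℝ) : ∑' h, decay b h = 1 + nonzeroMass b := by
  rw [nonzeroMass, ← ENNReal.summable.tsum_add_tsum_compl (s := {0}) ENNReal.summable,
    tsum_singleton, decay_zero]

lemma summable_zeta {b : ℝ} (hb : 1 < b) : Summable fun n : ℕ => ((n : ℝ) + 1) ^ (-b) := by
  simpa using (summable_nat_add_iff 1).2 (Real.summable_nat_rpow.2 (by linarith : -b < -1))

lemma decay_natCast_add_one (b : ℝ) (n : ℕ) : decay b ((n : ℤ) + 1) =
    ENNReal.ofReal ((1 / (2 * Real.pi)) ^ b) * ENNReal.ofReal (((n : ℝ) + 1) ^ (-b)) := by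
  rw [decay_of_ne_zero b (by lia), ← ENNReal.ofReal_mul (by positivity), one_div,
    ← Real.rpow_neg_eq_inv_rpow, ← Real.mul_rpow (by positivity) (by positivity)]
  congr 3
  push_cast
  exact abs_of_nonneg (by positivity)

lemma nonzeroMass_eq {b : ℝ} (hb : 1 < b) :
    nonzeroMass b = ENNReal.ofReal (2 * (1 / (2 * Real.pi)) ^ b * zeta b) := by
  have hpos : ∑' n : ℕ, decay b ((n : ℤ) + 1) =
      ENNReal.ofReal ((1 / (2 * Real.pi)) ^ b * zeta b) := by
    simp only [decay_natCast_add_one]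
    rw [ENNReal.tsum_mul_left, ENNReal.ofReal_mul (by positivity), zeta,
      ENNReal.ofReal_tsum_of_nonneg (fun n => by positivity) (summable_zeta hb)]
  have hind : ∀ h : ℤ, h ≠ 0 → Set.indicator {0}ᶜ (decay b) h = decay b h := fun h hh =>
    Set.indicator_of_mem hh _
  have hsucc (n : ℕ) : (n : ℤ) + 1 ≠ 0 := by lia
  rw [nonzeroMass, tsum_subtype, tsum_of_add_one_of_neg_add_one ENNReal.summable ENNReal.summable]
  simp only [hind _ (hsucc _), hind _ (neg_ne_zero.2 (hsucc _)), decay_neg, hpos,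
    Set.mem_compl_iff, Set.mem_singleton_iff, not_true_eq_false, not_false_eq_true,
    Set.indicator_of_notMem, add_zero]
  rw [← two_mul, mul_assoc, ENNReal.ofReal_mul zero_le_two, ENNReal.ofReal_ofNat]

lemma decay_le_of_abs_le {b : ℝ} (hb : 0 ≤ b) {h l : ℤ} (hl : l ≠ 0) (hlh : |l| ≤ 2 * |h|) :
    decay b h ≤ 2 ^ b * decay b l := by
  have hh : h ≠ 0 := by
    rintro rfl
    exact hl (by simpa using hlh)
  have hlh' : |(l : ℝ)| ≤ 2 * |(h : ℝ)| := by exact_mod_cast hlh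
  rw [decay_of_ne_zero b hh, decay_of_ne_zero b hl, ← ENNReal.ofReal_ofNat 2,
    ENNReal.ofReal_rpow_of_pos two_pos, ← ENNReal.ofReal_mul (by positivity)]
  refine ENNReal.ofReal_le_ofReal ?_
  calc (2 * Real.pi * |(h : ℝ)|) ^ (-b) ≤ (2⁻¹ * (2 * Real.pi * |(l : ℝ)|)) ^ (-b) := by
        refine Real.rpow_le_rpow_of_nonpos (by positivity) ?_ (by linarith)
        nlinarith [Real.pi_pos]
    _ = 2 ^ b * (2 * Real.pi * |(l : ℝ)|) ^ (-b) := by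
        rw [Real.mul_rpow (by positivity) (by positivity), ← Real.rpow_neg_eq_inv_rpow, neg_neg]

lemma decay_mul_decay_add_le {b : ℝ} (hb : 0 ≤ b) {l : ℤ} (hl : l ≠ 0) (h : ℤ) :
    decay b h * decay b (h + l) ≤ (if h = 0 then decay b l else 0) +
      (if h = -l then decay b l else 0) + 2 ^ b * decay b l *
        (Set.indicator {0}ᶜ (decay b) h + Set.indicator {0}ᶜ (decay b) (h + l)) := by
  rcases eq_or_ne h 0 with rfl | h0
  · simp [add_assoc]
  rcases eq_or_ne h (-l) with rfl | h1
  · simp [hl]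
  have h2 : h + l ≠ 0 := fun h2 => h1 (eq_neg_of_add_eq_zero_left h2)
  rw [if_neg h0, if_neg h1, zero_add, zero_add, Set.indicator_of_mem h0, Set.indicator_of_mem h2,
    mul_add]
  have hmax : |l| ≤ 2 * |h| ∨ |l| ≤ 2 * |h + l| := by grind
  rcases hmax with hle | hle
  · exact le_add_of_le_right (by gcongr; exact decay_le_of_abs_le hb hl hle)
  · rw [mul_comm (decay b h)]
    exact le_add_of_le_left (by gcongr; exact decay_le_of_abs_le hb hl hle)

lemma autocorr_decay_le {b : ℝ} (hb : 0 ≤ b) {l : ℤ} (hl : l ≠ 0) :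
    autocorr (decay b) l ≤ decay b l * (2 + 2 ^ (b + 1) * nonzeroMass b) := by
  have hmass : ∑' h, Set.indicator {0}ᶜ (decay b) h = nonzeroMass b := (tsum_subtype _ _).symm
  have hshift : ∑' h, Set.indicator {0}ᶜ (decay b) (h + l) = nonzeroMass b :=
    ((Equiv.addRight l).tsum_eq (Set.indicator {0}ᶜ (decay b))).trans hmass
  refine (ENNReal.tsum_le_tsum (decay_mul_decay_add_le hb hl)).trans_eq ?_
  rw [ENNReal.tsum_add, ENNReal.tsum_add, tsum_ite_eq, tsum_ite_eq, ENNReal.tsum_mul_left,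
    ENNReal.tsum_add, hmass, hshift, ENNReal.rpow_add _ _ two_ne_zero ENNReal.ofNat_ne_top,
    ENNReal.rpow_one]
  ring

lemma natCast_mul_decay_mul_le {b : ℝ} (hb : 1 ≤ b) {N : ℕ} (hN : 1 ≤ N) {m : ℤ} (hm : m ≠ 0) :
    N * decay b (N * m) ≤ decay b m := by
  have hN' : (1 : ℝ) ≤ N := by exact_mod_cast hN
  have hbase : 2 * Real.pi * |((N * m : ℤ) : ℝ)| = N * (2 * Real.pi * |(m : ℝ)|) := by
    push_cast
    rw [abs_mul, Nat.abs_cast]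
    ring
  rw [decay_of_ne_zero b hm, decay_of_ne_zero b (mul_ne_zero (by lia) hm),
    ← ENNReal.ofReal_natCast, ← ENNReal.ofReal_mul (by positivity)]
  refine ENNReal.ofReal_le_ofReal ?_
  calc (N : ℝ) * (2 * Real.pi * |((N * m : ℤ) : ℝ)|) ^ (-b)
      = N ^ (1 - b) * (2 * Real.pi * |(m : ℝ)|) ^ (-b) := by
        rw [hbase, Real.mul_rpow (by positivity) (by positivity), sub_eq_add_neg,
          Real.rpow_add (by positivity), Real.rpow_one, mul_assoc (N : ℝ)]
    _ ≤ (2 * Real.pi * |(m : ℝ)|) ^ (-b) :=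
        mul_le_of_le_one_left (by positivity)
          (Real.rpow_le_one_of_one_le_of_nonpos hN' (by linarith))

/-- The nonzero multiples of `N`. -/
def nonzeroMultiples (N : ℕ) : Set ℤ := {l | l ≠ 0 ∧ (N : ℤ) ∣ l}

lemma nonzeroMultiples_eq_image {N : ℕ} (hN : 1 ≤ N) :
    nonzeroMultiples N = (fun m : ℤ => (N : ℤ) * m) '' {0}ᶜ := by
  ext l
  constructor
  · rintro ⟨hl, m, rfl⟩
    exact ⟨m, right_ne_zero_of_mul hl, rfl⟩
  · rintro ⟨m, hm, rfl⟩
    exact ⟨mul_ne_zero (by lia) hm, dvd_mul_right _ _⟩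

lemma natCast_mul_tsum_decay_nonzeroMultiples_le {b : ℝ} (hb : 1 ≤ b) {N : ℕ} (hN : 1 ≤ N) :
    N * ∑' l : nonzeroMultiples N, decay b l ≤ nonzeroMass b := by
  have hinj : Function.Injective fun m : ℤ => (N : ℤ) * m := mul_right_injective₀ (by lia)
  rw [nonzeroMultiples_eq_image hN, tsum_image _ hinj.injOn, ← ENNReal.tsum_mul_left]
  exact ENNReal.tsum_le_tsum fun m => natCast_mul_decay_mul_le hb hN m.2

lemma natCast_mul_tsum_autocorr_nonzeroMultiples_le {b : ℝ} (hb : 1 ≤ b) {N : ℕ} (hN : 1 ≤ N) :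
    N * ∑' l : nonzeroMultiples N, autocorr (decay b) l ≤
      nonzeroMass b * (2 + 2 ^ (b + 1) * nonzeroMass b) := by
  calc N * ∑' l : nonzeroMultiples N, autocorr (decay b) l
      ≤ N * ∑' l : nonzeroMultiples N, decay b l * (2 + 2 ^ (b + 1) * nonzeroMass b) := by
        gcongr with l
        exact autocorr_decay_le (by linarith) l.2.1
    _ ≤ nonzeroMass b * (2 + 2 ^ (b + 1) * nonzeroMass b) := by
        rw [ENNReal.tsum_mul_right, ← mul_assoc]
        gcongr
        exact natCast_mul_tsum_decay_nonzeroMultiples_le hb hN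

/-! ### The dual lattice and the component-by-component criterion -/

/-- The product weight `∏_j decay b (h_j)` on `ℤ^d`. -/
def decayProd {d : ℕ} (b : ℝ) (h : Fin d → ℤ) : ℝ≥0∞ := ∏ j, decay b (h j)

/-- The dual lattice `{ℓ ∈ ℤ^d | ℓ·z ≡ 0 (mod N)}` of the rank-1 lattice generated by `z / N`. -/
def dualLattice {d : ℕ} (N : ℕ) (z : Fin d → ℕ) : AddSubgroup (Fin d → ℤ) where
  carrier := {l | (N : ℤ) ∣ ∑ j, l j * z j}
  zero_mem' := by simp
  add_mem' {l m} hl hm := by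
    simpa only [Set.mem_ofPred_eq, Pi.add_apply, add_mul, Finset.sum_add_distrib] using hl.add hm
  neg_mem' {l} hl := by
    simpa only [Set.mem_ofPred_eq, Pi.neg_apply, neg_mul, Finset.sum_neg_distrib, dvd_neg] using hl

/-- The vectors whose last nonzero component is the one with index `s`. -/
def lastNonzero {d : ℕ} (s : Fin d) : Set (Fin d → ℤ) := {l | l s ≠ 0 ∧ ∀ j, s < j → l j = 0}

lemma mem_dualLattice {d N : ℕ} {z : Fin d → ℕ} {l : Fin d → ℤ} :
    l ∈ dualLattice N z ↔ (N : ℤ) ∣ ∑ j, l j * z j := Iff.rfl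

lemma autocorr_decayProd {d : ℕ} (b : ℝ) (l : Fin d → ℤ) :
    autocorr (decayProd b) l = ∏ j, autocorr (decay b) (l j) := autocorr_prod (decay b) l

lemma tsum_decayProd {d : ℕ} (b : ℝ) :
    ∑' h : Fin d → ℤ, decayProd b h = (1 + nonzeroMass b) ^ d := by
  simp only [decayProd, tsum_pi_prod fun _ : Fin d => decay b, tsum_decay, Finset.prod_const,
    Finset.card_univ, Fintype.card_fin]

lemma decayProd_rpow {d : ℕ} (b : ℝ) {p : ℝ} (hp : 0 ≤ p) (h : Fin d → ℤ) :
    decayProd b h ^ p = decayProd (b * p) h := by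
  simp only [decayProd, ← ENNReal.prod_rpow_of_nonneg hp, decay_rpow]

lemma ofReal_inv_weight₁_half_sq (α : ℕ) (h : ℤ) :
    ENNReal.ofReal (weight₁ α (1 / 2) h ^ 2)⁻¹ = decay (2 * α) h := by
  rcases eq_or_ne h 0 with rfl | hh
  · simp [weight₁]
  · have hbase : |Real.pi * h / (1 / 2)| = 2 * Real.pi * |(h : ℝ)| := by
      rw [show Real.pi * h / (1 / 2) = 2 * Real.pi * h by ring, abs_mul,
        abs_of_pos Real.two_pi_pos]
    rw [weight₁, if_neg hh, decay_of_ne_zero _ hh, hbase, ← pow_mul, Real.rpow_neg (by positivity)]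
    norm_cast
    rw [mul_comm α]

lemma ofReal_inv_weight_half_sq {d : ℕ} (α : ℕ) (h : Fin d → ℤ) :
    ENNReal.ofReal (weight α (1 / 2) h ^ 2)⁻¹ = decayProd (2 * α) h := by
  rw [weight, ← Finset.prod_pow, ← Finset.prod_inv_distrib,
    ENNReal.ofReal_prod_of_nonneg fun j _ => by positivity]
  exact Finset.prod_congr rfl fun j _ => ofReal_inv_weight₁_half_sq α (h j)

lemma nonzeroMass_ne_top {b : ℝ} (hb : 1 < b) : nonzeroMass b ≠ ∞ :=
  nonzeroMass_eq hb ▸ ENNReal.ofReal_ne_top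

lemma tsum_decayProd_ne_top {d : ℕ} {b : ℝ} (hb : 1 < b) :
    ∑' h : Fin d → ℤ, decayProd b h ≠ ∞ :=
  tsum_decayProd (d := d) b ▸
    ENNReal.pow_ne_top (ENNReal.add_ne_top.2 ⟨ENNReal.one_ne_top, nonzeroMass_ne_top hb⟩)

lemma ofReal_cbcCriterion {d α : ℕ} (hα : 1 ≤ α) (N : ℕ) (s : Fin d) (z : Fin d → ℕ) :
    ENNReal.ofReal (cbcCriterion α N s z) =
      ∑' l : ↥((dualLattice N z : Set (Fin d → ℤ)) ∩ lastNonzero s),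
        autocorr (decayProd (2 * α)) l.1 := by
  classical
  let A : Set (Fin d → ℤ) := dualLattice N z ∩ lastNonzero s
  let F (p : (Fin d → ℤ) × (Fin d → ℤ)) : ℝ≥0∞ :=
    A.indicator (fun l => decayProd (2 * α) p.1 * decayProd (2 * α) (p.1 + l)) p.2
  have hα' : (1 : ℝ) < 2 * α := by exact_mod_cast (by lia : 1 < 2 * α)
  have hF : ∑' p, F p = ∑' l : A, autocorr (decayProd (2 * α)) l.1 := by
    rw [ENNReal.tsum_prod', ENNReal.tsum_comm, tsum_subtype]
    refine tsum_congr fun l => ?_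
    by_cases hl : l ∈ A <;> simp [F, hl, autocorr]
  have hF_top : ∑' p, F p ≠ ∞ := by
    refine ne_top_of_le_ne_top (ENNReal.pow_ne_top (n := 2) (tsum_decayProd_ne_top (d := d) hα')) ?_
    rw [hF, ← tsum_autocorr]
    exact ENNReal.tsum_comp_le_tsum_of_injective Subtype.val_injective _
  have hcbc : cbcCriterion α N s z = (∑' p, F p).toReal := by
    rw [cbcCriterion, ENNReal.tsum_toReal_eq (ENNReal.ne_top_of_tsum_ne_top hF_top)]
    refine tsum_congr fun p => ?_
    have hA : p.2 ∈ A ↔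
        p.2 s ≠ 0 ∧ (∀ j, s < j → p.2 j = 0) ∧ (N : ℤ) ∣ ∑ j, p.2 j * (z j : ℤ) := by
      rw [← and_assoc]
      exact and_comm
    simp only [F, ← ofReal_inv_weight_half_sq, ← ENNReal.ofReal_mul (inv_nonneg.2 (sq_nonneg _)),
      ← mul_inv, Set.indicator_apply, hA, apply_ite ENNReal.toReal, ENNReal.toReal_zero,
      ENNReal.toReal_ofReal (inv_nonneg.2 (mul_nonneg (sq_nonneg _) (sq_nonneg _)))]
  rw [hcbc, ENNReal.ofReal_toReal hF_top, hF]

lemma iUnion_lastNonzero {d : ℕ} : ⋃ s : Fin d, lastNonzero s = {0}ᶜ := by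
  ext l
  simp only [Set.mem_iUnion, Set.mem_compl_iff, Set.mem_singleton_iff]
  constructor
  · rintro ⟨s, hs, -⟩ rfl
    exact hs rfl
  · intro hl
    classical
    obtain ⟨i, hi⟩ := Function.ne_iff.1 hl
    let support := Finset.univ.filter fun j => l j ≠ 0
    have hne : support.Nonempty := ⟨i, by simpa [support] using hi⟩
    refine ⟨support.max' hne, by simpa [support] using support.max'_mem hne, fun j hj => ?_⟩
    by_contra hlj
    exact hj.not_ge (support.le_max' j (by simpa [support] using hlj))

lemma pairwise_disjoint_lastNonzero {d : ℕ} :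
    Pairwise (Function.onFun Disjoint (lastNonzero (d := d))) := by
  intro s t hst
  refine Set.disjoint_left.2 fun l hs ht => ?_
  rcases hst.lt_or_gt with h | h
  · exact ht.1 (hs.2 t h)
  · exact hs.1 (ht.2 s h)

lemma sum_tsum_inter_lastNonzero {d : ℕ} (A : Set (Fin d → ℤ)) (F : (Fin d → ℤ) → ℝ≥0∞) :
    ∑ s, ∑' l : ↥(A ∩ lastNonzero s), F l = ∑' l : ↥(A \ {0}), F l := by
  rw [Set.sdiff_eq, ← iUnion_lastNonzero, Set.inter_iUnion, ENNReal.tsum_biUnion, tsum_fintype]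
  exact fun s _ t _ hst =>
    (pairwise_disjoint_lastNonzero hst).mono Set.inter_subset_right Set.inter_subset_right

lemma eq_of_mem_dualLattice_update {d N : ℕ} (hN : N.Prime) {s : Fin d} {z : Fin d → ℕ}
    {l : Fin d → ℤ} (hl : ¬ (N : ℤ) ∣ l s) {c c' : ℕ} (hc : c < N) (hc' : c' < N)
    (hmem : l ∈ dualLattice N (Function.update z s c))
    (hmem' : l ∈ dualLattice N (Function.update z s c')) : c = c' := by
  have hdiff : ∑ j, l j * (Function.update z s c j : ℤ) -
      ∑ j, l j * (Function.update z s c' j : ℤ) = l s * (c - c') := by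
    rw [← Finset.sum_sub_distrib, Finset.sum_eq_single s (fun j _ hj => by simp [hj]) (by simp)]
    simp [mul_sub]
  have hdvd : (N : ℤ) ∣ c - c' :=
    ((Nat.prime_iff_prime_int.1 hN).dvd_or_dvd (hdiff ▸ dvd_sub hmem hmem')).resolve_left hl
  exact_mod_cast sub_eq_zero.1 (Int.eq_zero_of_abs_lt_dvd hdvd (by rw [abs_lt]; lia))

lemma sum_tsum_dualLattice_update_le {d N : ℕ} (hN : N.Prime) (s : Fin d) (z : Fin d → ℕ)
    (F : (Fin d → ℤ) → ℝ≥0∞) :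
    ∑ c ∈ Finset.Ico 1 N, ∑' l : ↥((dualLattice N (Function.update z s c) : Set (Fin d → ℤ)) ∩
        lastNonzero s), F l ≤
      ∑' l : lastNonzero s, F l +
        (N - 1 : ℕ) * ∑' l : {l : Fin d → ℤ | l s ∈ nonzeroMultiples N}, F l := by
  classical
  simp only [tsum_subtype]
  rw [← Summable.tsum_finsetSum fun _ _ => ENNReal.summable, ← ENNReal.tsum_mul_left,
    ← ENNReal.tsum_add]
  refine ENNReal.tsum_le_tsum fun l => ?_
  by_cases hl : l ∈ lastNonzero s
  swap
  · simp [hl]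
  simp only [Set.indicator_apply, Set.mem_inter_iff, hl, and_true, SetLike.mem_coe, if_true]
  rw [← Finset.sum_filter, Finset.sum_const, nsmul_eq_mul]
  by_cases hdvd : (N : ℤ) ∣ l s
  · rw [if_pos (show l ∈ {l : Fin d → ℤ | l s ∈ nonzeroMultiples N} from ⟨hl.1, hdvd⟩)]
    refine le_add_of_le_right ?_
    gcongr
    exact (Finset.card_filter_le _ _).trans_eq (Nat.card_Ico 1 N)
  · refine le_add_of_le_left (mul_le_of_le_one_left' ?_)
    refine Nat.cast_le_one.2 (Finset.card_le_one.2 fun c hc c' hc' => ?_)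
    simp only [Finset.mem_filter, Finset.mem_Ico] at hc hc'
    exact eq_of_mem_dualLattice_update hN hdvd hc.1.2 hc'.1.2 hc.2 hc'.2

lemma tsum_prod_of_mem {β : Type*} {d : ℕ} (g : β → ℝ≥0∞) (s : Fin d) (D : Set β) :
    ∑' l : {l : Fin d → β | l s ∈ D}, ∏ j, g (l.1 j) =
      (∑' b : D, g b) * (∑' b, g b) ^ (d - 1) := by
  let G : Fin d → β → ℝ≥0∞ := Function.update (fun _ => g) s (D.indicator g)
  have hG {j : Fin d} (hj : j ∈ Finset.univ.erase s) : G j = g :=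
    Function.update_of_ne (Finset.ne_of_mem_erase hj) _ _
  have hGs : G s = D.indicator g := Function.update_self _ _ _
  have hind (l : Fin d → β) :
      Set.indicator {l : Fin d → β | l s ∈ D} (fun l => ∏ j, g (l j)) l = ∏ j, G j (l j) := by
    rw [← Finset.mul_prod_erase _ _ (Finset.mem_univ s), hGs,
      Finset.prod_congr rfl fun j hj => congrFun (hG hj) (l j)]
    by_cases hl : l s ∈ D
    · simp only [Set.indicator_of_mem hl,
        Finset.mul_prod_erase _ (fun j => g (l j)) (Finset.mem_univ s),
        Set.indicator_of_mem (show l ∈ {l : Fin d → β | l s ∈ D} from hl)]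
    · simp [hl]
  rw [tsum_subtype {l : Fin d → β | l s ∈ D} fun l => ∏ j, g (l j)]
  simp only [hind, tsum_pi_prod]
  rw [← Finset.mul_prod_erase _ _ (Finset.mem_univ s), hGs, tsum_subtype,
    Finset.prod_congr rfl fun j hj => by rw [hG hj]]
  simp

/-- `∑_s T_{d,s}(z)`, the full criterion `S_d(z)`. -/
def cbcSum {d : ℕ} (α N : ℕ) (z : Fin d → ℕ) : ℝ≥0∞ :=
  ∑' l : ↥((dualLattice N z : Set (Fin d → ℤ)) \ {0}), autocorr (decayProd (2 * α)) l.1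

lemma IsCBCVector.rpow_cbcCriterion_le {d α N : ℕ} (hα : 1 ≤ α) (hN : N.Prime) {z : Fin d → ℕ}
    (hz : IsCBCVector α N z) (s : Fin d) {q : ℝ} (hq : 0 < q) (hq1 : q ≤ 1) :
    (N - 1 : ℕ) * ENNReal.ofReal (cbcCriterion α N s z) ^ q ≤
      ∑' l : lastNonzero s, autocorr (decayProd (2 * α * q)) l.1 +
        (N - 1 : ℕ) * ∑' l : {l : Fin d → ℤ | l s ∈ nonzeroMultiples N},
          autocorr (decayProd (2 * α * q)) l.1 := by
  refine le_trans ?_ (sum_tsum_dualLattice_update_le hN s z fun l =>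
    autocorr (decayProd (2 * α * q)) l)
  rw [← Nat.card_Ico 1 N, ← nsmul_eq_mul]
  refine Finset.card_nsmul_le_sum _ _ _ fun c hc => ?_
  obtain ⟨hc1, hcN⟩ := Finset.mem_Ico.1 hc
  calc ENNReal.ofReal (cbcCriterion α N s z) ^ q
      ≤ ENNReal.ofReal (cbcCriterion α N s (Function.update z s c)) ^ q := by
        gcongr
        exact (hz s).2 c hc1 hcN
    _ ≤ _ := by
        rw [ofReal_cbcCriterion hα]
        refine (rpow_tsum_le_tsum_rpow _ hq hq1).trans (ENNReal.tsum_le_tsum fun l => ?_)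
        refine (autocorr_rpow_le _ _ hq hq1).trans_eq ?_
        simp only [decayProd_rpow _ hq.le]

lemma natCast_mul_tsum_autocorr_decayProd_le {d N : ℕ} {b : ℝ} (hb : 1 ≤ b) (hN : 1 ≤ N)
    (s : Fin d) :
    N * ∑' l : {l : Fin d → ℤ | l s ∈ nonzeroMultiples N}, autocorr (decayProd b) l.1 ≤
      nonzeroMass b * (2 + 2 ^ (b + 1) * nonzeroMass b) * ((1 + nonzeroMass b) ^ 2) ^ (d - 1) := by
  simp only [autocorr_decayProd]
  rw [tsum_prod_of_mem, tsum_autocorr, tsum_decay, ← mul_assoc]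
  refine mul_le_mul_left ?_ _
  exact natCast_mul_tsum_autocorr_nonzeroMultiples_le hb hN

/-- The sum `∑_u max(|u|, 1) w^{|u|}` over `u ⊆ {1, …, d}`, which occurs in the error constant. -/
def subsetSum (d : ℕ) (w : ℝ≥0∞) : ℝ≥0∞ :=
  ∑ u : Finset (Fin d), ((max u.card 1 : ℕ) : ℝ≥0∞) * w ^ u.card

lemma one_add_pow_le_subsetSum (d : ℕ) (w : ℝ≥0∞) : (1 + w) ^ d ≤ subsetSum d w := by
  rw [add_comm, ← Fin.sum_pow_mul_eq_add_pow]
  refine Finset.sum_le_sum fun u _ => ?_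
  rw [one_pow, mul_one]
  exact le_mul_of_one_le_left' (by exact_mod_cast le_max_right _ _)

lemma mul_one_add_pow_le_subsetSum (d : ℕ) (w : ℝ≥0∞) :
    d * (w * (1 + w) ^ (d - 1)) ≤ subsetSum d w := by
  obtain _ | m := d
  · simp
  have hcard : subsetSum (m + 1) w =
      ∑ k ∈ Finset.range (m + 2), (m + 1).choose k • (((max k 1 : ℕ) : ℝ≥0∞) * w ^ k) := by
    rw [subsetSum, ← Finset.powerset_univ, Finset.sum_powerset_apply_card
      (fun k => ((max k 1 : ℕ) : ℝ≥0∞) * w ^ k), Finset.card_univ, Fintype.card_fin]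
  rw [hcard, Finset.sum_range_succ', Nat.add_sub_cancel, add_comm 1 w, add_pow, Finset.mul_sum,
    Finset.mul_sum]
  refine le_add_of_le_left (Finset.sum_le_sum fun k _ => le_of_eq ?_)
  have hchoose : ((m + 1 : ℕ) : ℝ≥0∞) * m.choose k = (m + 1).choose (k + 1) * (k + 1 : ℕ) := by
    exact_mod_cast Nat.add_one_mul_choose_eq m k
  rw [max_eq_left (Nat.succ_pos k), nsmul_eq_mul, ← mul_assoc ((m + 1).choose (k + 1) : ℝ≥0∞),
    ← hchoose, one_pow]
  ring

lemma natCast_mul_le_of_pred_mul_le {N : ℕ} (hN : 2 ≤ N) {x y z : ℝ≥0∞}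
    (h : (N - 1 : ℕ) * x ≤ y + (N - 1 : ℕ) * z) : N * x ≤ 2 * y + N * z := by
  have hpos : ((N - 1 : ℕ) : ℝ≥0∞) ≠ 0 := by
    exact_mod_cast (by lia : N - 1 ≠ 0)
  have hle : (N : ℝ≥0∞) ≤ 2 * (N - 1 : ℕ) := by exact_mod_cast (by lia : N ≤ 2 * (N - 1))
  refine (ENNReal.mul_le_mul_iff_right hpos (ENNReal.natCast_ne_top _)).1 ?_
  calc (N - 1 : ℕ) * (N * x) = N * ((N - 1 : ℕ) * x) := mul_left_comm _ _ _
    _ ≤ N * (y + (N - 1 : ℕ) * z) := by gcongr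
    _ = N * y + (N - 1 : ℕ) * (N * z) := by ring
    _ ≤ 2 * (N - 1 : ℕ) * y + (N - 1 : ℕ) * (N * z) := by gcongr
    _ = (N - 1 : ℕ) * (2 * y + N * z) := by ring

lemma sum_tsum_lastNonzero_le {d : ℕ} (F : (Fin d → ℤ) → ℝ≥0∞) :
    ∑ s, ∑' l : lastNonzero s, F l.1 ≤ ∑' l, F l := by
  rw [← tsum_fintype (L := .unconditional _),
    ← ENNReal.tsum_biUnion fun s _ t _ hst => pairwise_disjoint_lastNonzero hst]
  exact ENNReal.tsum_comp_le_tsum_of_injective Subtype.val_injective F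

lemma natCast_mul_sum_tsum_autocorr_decayProd_le {d N : ℕ} {b : ℝ} (hb : 1 ≤ b) (hN : 1 ≤ N) :
    N * ∑ s, ∑' l : {l : Fin d → ℤ | l s ∈ nonzeroMultiples N}, autocorr (decayProd b) l.1 ≤
      (2 + 2 ^ (b + 1)) * subsetSum d (nonzeroMass b) ^ 2 := by
  set w := nonzeroMass b
  set Q := subsetSum d w
  have hQ : (1 + w) ^ (d - 1) ≤ Q :=
    (pow_le_pow_right₀ le_self_add (Nat.sub_le d 1)).trans (one_add_pow_le_subsetSum d w)
  have hQ' : d * (w * (1 + w) ^ (d - 1)) ≤ Q := mul_one_add_pow_le_subsetSum d w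
  have hd : (d : ℝ≥0∞) ≤ d * d := by exact_mod_cast Nat.le_mul_self d
  calc N * ∑ s, ∑' l : {l : Fin d → ℤ | l s ∈ nonzeroMultiples N}, autocorr (decayProd b) l.1
      ≤ ∑ _s : Fin d, w * (2 + 2 ^ (b + 1) * w) * ((1 + w) ^ 2) ^ (d - 1) := by
        rw [Finset.mul_sum]
        exact Finset.sum_le_sum fun s _ => natCast_mul_tsum_autocorr_decayProd_le hb hN s
    _ = 2 * (d * (w * (1 + w) ^ (d - 1))) * (1 + w) ^ (d - 1) +
          2 ^ (b + 1) * (d * (w * (1 + w) ^ (d - 1)) ^ 2) := by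
        rw [Finset.sum_const, Finset.card_univ, Fintype.card_fin, nsmul_eq_mul, ← pow_mul,
          mul_comm 2, pow_mul]
        ring
    _ ≤ 2 * Q * Q + 2 ^ (b + 1) * (d * d * (w * (1 + w) ^ (d - 1)) ^ 2) := by gcongr
    _ = 2 * Q * Q + 2 ^ (b + 1) * (d * (w * (1 + w) ^ (d - 1))) ^ 2 := by ring
    _ ≤ 2 * Q * Q + 2 ^ (b + 1) * Q ^ 2 := by gcongr
    _ = (2 + 2 ^ (b + 1)) * Q ^ 2 := by ring

lemma sum_ofReal_cbcCriterion {d α : ℕ} (hα : 1 ≤ α) (N : ℕ) (z : Fin d → ℕ) :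
    ∑ s, ENNReal.ofReal (cbcCriterion α N s z) = cbcSum α N z := by
  simp only [ofReal_cbcCriterion hα]
  exact sum_tsum_inter_lastNonzero _ _

lemma IsCBCVector.natCast_mul_rpow_cbcSum_le {d α N : ℕ} (hα : 1 ≤ α) (hN : N.Prime)
    {z : Fin d → ℕ} (hz : IsCBCVector α N z) {q : ℝ} (hq : 1 ≤ 2 * α * q) (hq1 : q ≤ 1) :
    N * cbcSum α N z ^ q ≤
      (4 + 2 ^ (2 * α * q + 1)) * subsetSum d (nonzeroMass (2 * α * q)) ^ 2 := by
  have hq0 : 0 < q := pos_of_mul_pos_right (by linarith : 0 < 2 * α * q) (by positivity)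
  set b : ℝ := 2 * α * q
  set w := nonzeroMass b
  let multiples (s : Fin d) : ℝ≥0∞ :=
    ∑' l : {l : Fin d → ℤ | l s ∈ nonzeroMultiples N}, autocorr (decayProd b) l.1
  have hsum : (N - 1 : ℕ) * cbcSum α N z ^ q ≤
      ((1 + w) ^ d) ^ 2 + (N - 1 : ℕ) * ∑ s, multiples s := by
    calc (N - 1 : ℕ) * cbcSum α N z ^ q
        ≤ ∑ s, (N - 1 : ℕ) * ENNReal.ofReal (cbcCriterion α N s z) ^ q := by
          rw [← sum_ofReal_cbcCriterion hα, ← Finset.mul_sum]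
          gcongr
          exact rpow_sum_le_sum_rpow _ _ hq0 hq1
      _ ≤ ∑ s, (∑' l : lastNonzero s, autocorr (decayProd b) l.1 +
            (N - 1 : ℕ) * multiples s) :=
          Finset.sum_le_sum fun s _ => hz.rpow_cbcCriterion_le hα hN s hq0 hq1
      _ ≤ ((1 + w) ^ d) ^ 2 + (N - 1 : ℕ) * ∑ s, multiples s := by
          rw [Finset.sum_add_distrib, ← Finset.mul_sum, ← tsum_decayProd, ← tsum_autocorr]
          gcongr
          exact sum_tsum_lastNonzero_le _
  calc N * cbcSum α N z ^ q ≤ 2 * ((1 + w) ^ d) ^ 2 + N * ∑ s, multiples s :=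
        natCast_mul_le_of_pred_mul_le hN.two_le hsum
    _ ≤ 2 * subsetSum d w ^ 2 + (2 + 2 ^ (b + 1)) * subsetSum d w ^ 2 := by
        gcongr ?_ + ?_
        · gcongr
          exact one_add_pow_le_subsetSum d w
        · exact natCast_mul_sum_tsum_autocorr_decayProd_le hq hN.one_le
    _ = (4 + 2 ^ (b + 1)) * subsetSum d w ^ 2 := by ring

lemma exists_greedy_min {ι β γ : Type*} [LinearOrder ι] [WellFoundedLT ι] [LinearOrder γ]
    {S : Finset β} (hS : S.Nonempty) {T : ι → (ι → β) → γ}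
    (hT : ∀ s z z', (∀ j ≤ s, z j = z' j) → T s z = T s z') :
    ∃ z : ι → β, ∀ s, z s ∈ S ∧ ∀ c ∈ S, T s z ≤ T s (Function.update z s c) := by
  obtain ⟨b₀, -⟩ := id hS
  choose best best_mem best_le using fun (s : ι) (y : ι → β) =>
    S.exists_min_image (fun c => T s (Function.update y s c)) hS
  let z : ι → β := wellFounded_lt.fix fun s prev =>
    best s fun j => if hj : j < s then prev j hj else b₀
  have hz (s : ι) : z s = best s fun j => if j < s then z j else b₀ :=
    wellFounded_lt.fix_eq _ s
  refine ⟨z, fun s => ⟨hz s ▸ best_mem s _, fun c hc => ?_⟩⟩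
  have htrunc (c : β) : T s (Function.update (fun j => if j < s then z j else b₀) s c) =
      T s (Function.update z s c) := by
    refine hT s _ _ fun j hj => ?_
    rcases hj.eq_or_lt with rfl | hlt
    · simp
    · simp [hlt.ne, hlt]
  have hle := best_le s (fun j => if j < s then z j else b₀) c hc
  rwa [← hz s, htrunc, htrunc, Function.update_eq_self] at hle

lemma cbcCriterion_congr {d : ℕ} (α N : ℕ) (s : Fin d) {z z' : Fin d → ℕ}
    (h : ∀ j ≤ s, z j = z' j) : cbcCriterion α N s z = cbcCriterion α N s z' := by
  have hdvd {l : Fin d → ℤ} (hl : ∀ j, s < j → l j = 0) :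
      (N : ℤ) ∣ ∑ j, l j * (z j : ℤ) ↔ (N : ℤ) ∣ ∑ j, l j * (z' j : ℤ) := by
    rw [Finset.sum_congr rfl fun j _ => ?_]
    rcases le_or_gt j s with hj | hj
    · rw [h j hj]
    · rw [hl j hj, zero_mul, zero_mul]
  exact tsum_congr fun p => if_congr (and_congr_right fun _ => and_congr_right hdvd) rfl rfl

lemma exists_isCBCVector {N : ℕ} (hN : 2 ≤ N) (α d : ℕ) :
    ∃ z : Fin d → ℕ, IsCBCVector α N z := by
  obtain ⟨z, hz⟩ := exists_greedy_min (Finset.nonempty_Ico.2 hN)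
    fun s z z' => cbcCriterion_congr (d := d) α N s
  exact ⟨z, fun s => ⟨Finset.mem_Ico.1 (hz s).1, fun c hc hcN =>
    (hz s).2 c (Finset.mem_Ico.2 ⟨hc, hcN⟩)⟩⟩

/-! ### Fourier series on the box -/

lemma integral_exp_two_pi_mul_int (n : ℤ) :
    ∫ t in (0 : ℝ)..1, Complex.exp (((2 * Real.pi * n * t : ℝ) : ℂ) * Complex.I) =
      if n = 0 then 1 else 0 := by
  split_ifs with hn
  · simp [hn]
  · have hc : 2 * Real.pi * n * Complex.I ≠ 0 := by simp [Real.pi_ne_zero, hn]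
    have hexp (t : ℝ) : ((2 * Real.pi * n * t : ℝ) : ℂ) * Complex.I =
        2 * Real.pi * n * Complex.I * t := by push_cast; ring
    have hperiod : Complex.exp (2 * Real.pi * n * Complex.I) = 1 :=
      Complex.exp_eq_one_iff.2 ⟨n, by ring⟩
    simp only [hexp, integral_exp_mul_complex hc]
    simp [hperiod]

lemma trig_mul_conj {a : ℝ} (ha : 0 ≤ a) (h k : ℤ) (x : ℝ) :
    trig a h x * conj (trig a k x) = ((1 / (2 * a) : ℝ) : ℂ) *
      Complex.exp (((2 * Real.pi * (h - k : ℤ) * ((x + a) / (2 * a)) : ℝ) : ℂ) * Complex.I) := by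
  unfold trig
  rw [map_mul, Complex.conj_ofReal, ← Complex.exp_conj, map_mul, Complex.conj_ofReal,
    Complex.conj_I, mul_mul_mul_comm, ← Complex.exp_add, ← Complex.ofReal_mul, ← sq, div_pow,
    one_pow, Real.sq_sqrt (by positivity)]
  congr 2
  push_cast
  ring

lemma integral_trig_mul_conj {a : ℝ} (ha : 0 < a) (h k : ℤ) :
    ∫ x in Set.Icc (-a) a, trig a h x * conj (trig a k x) = if h = k then 1 else 0 := by
  have hsubst := intervalIntegral.integral_comp_div_add (a := -a) (b := a)
    (fun t : ℝ => Complex.exp (((2 * Real.pi * (h - k : ℤ) * t : ℝ) : ℂ) * Complex.I))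
    (c := 2 * a) (by positivity) (1 / 2)
  have hshift (x : ℝ) : x / (2 * a) + 1 / 2 = (x + a) / (2 * a) := by field_simp
  simp only [hshift, neg_add_cancel, zero_div, ← two_mul, div_self (by positivity : 2 * a ≠ 0),
    integral_exp_two_pi_mul_int, sub_eq_zero] at hsubst
  simp only [trig_mul_conj ha.le]
  rw [integral_const_mul, integral_Icc_eq_integral_Ioc,
    ← intervalIntegral.integral_of_le (by linarith), hsubst, Complex.real_smul, ← mul_assoc,
    ← Complex.ofReal_mul, one_div_mul_cancel (by positivity), Complex.ofReal_one, one_mul]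

lemma integral_trigProd_mul_conj {d : ℕ} {a : ℝ} (ha : 0 < a) (h k : Fin d → ℤ) :
    ∫ x : Box a d, trigProd a h x * conj (trigProd a k x) = if h = k then 1 else 0 := by
  simp only [trigProd, map_prod, ← Finset.prod_mul_distrib]
  refine (integral_subtype_comap (μ := (volume : Measure (Fin d → ℝ))) measurableSet_Icc
    fun y => ∏ j, trig a (h j) (y j) * conj (trig a (k j) (y j))).trans ?_
  rw [← Set.pi_univ_Icc, volume_pi, Measure.restrict_pi_pi,
    integral_fintype_prod_eq_prod (f := fun j y => trig a (h j) y * conj (trig a (k j) y))]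
  simp only [integral_trig_mul_conj ha, Finset.prod_boole, Finset.mem_univ, true_imp_iff,
    funext_iff]

lemma hasSum_integral_mul {d : ℕ} {a : ℝ} {c : (Fin d → ℤ) → ℂ} (hc : Summable fun h => ‖c h‖)
    {u v : Box a d → ℂ} (hu : ∀ x, HasSum (fun h => c h * trigProd a h x) (u x))
    (hv : Continuous v) :
    HasSum (fun h => c h * ∫ x, trigProd a h x * v x) (∫ x, u x * v x) := by
  have hint (h : Fin d → ℤ) : Integrable fun x => c h * trigProd a h x * v x :=
    ((continuous_const.mul (continuous_trigProd a h)).mul hv).integrable_of_hasCompactSupport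
      (HasCompactSupport.of_compactSpace _)
  have hsum := hasSum_integral_of_summable_integral_norm hint (by
    simp only [norm_mul, norm_trigProd, mul_assoc, integral_const_mul]
    exact hc.mul_right _)
  simp only [tsum_mul_right, (hu _).tsum_eq] at hsum
  simpa only [mul_assoc, integral_const_mul] using hsum

lemma coeff_eq_of_hasSum {d : ℕ} {a : ℝ} (ha : 0 < a) {c : (Fin d → ℤ) → ℂ}
    (hc : Summable fun h => ‖c h‖) {f : Box a d → ℝ}
    (hf : ∀ x, HasSum (fun h => c h * trigProd a h x) (f x : ℂ)) (k : Fin d → ℤ) :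
    coeff f k = c k := by
  have hsum := hasSum_integral_mul hc hf (v := fun x => conj (trigProd a k x))
    (Complex.continuous_conj.comp (continuous_trigProd a k))
  simp only [integral_trigProd_mul_conj ha, mul_ite, mul_one, mul_zero] at hsum
  exact (hsum.unique (hasSum_single k fun h hk => if_neg hk)).trans (if_pos rfl)

lemma summable_norm_coeff {d : ℕ} {a : ℝ} (ha : 0 < a) {f : Box a d → ℝ}
    (hf : HasFourierSeries f) : Summable fun h => ‖coeff f h‖ := by
  have hx : (fun _ : Fin d => -a) ∈ Set.Icc (fun _ : Fin d => -a) (fun _ : Fin d => a) :=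
    ⟨le_rfl, fun _ => by linarith⟩
  have hnorm := (hf ⟨_, hx⟩).summable.norm
  simp only [norm_mul, norm_trigProd] at hnorm
  exact (summable_mul_right_iff (by positivity)).1 hnorm

lemma hasSum_norm_sq_coeff {d : ℕ} {a : ℝ} (ha : 0 < a) {f : Box a d → ℝ}
    (hf : HasFourierSeries f) : HasSum (fun h => ‖coeff f h‖ ^ 2) (∫ x, f x ^ 2) := by
  have hsum := hasSum_integral_mul (summable_norm_coeff ha hf) hf
    (Complex.continuous_ofReal.comp hf.continuous)
  have hterm (h : Fin d → ℤ) :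
      coeff f h * ∫ x, trigProd a h x * f x = ((‖coeff f h‖ ^ 2 : ℝ) : ℂ) := by
    have hconj : ∫ x, trigProd a h x * f x = conj (coeff f h) := by
      simp [coeff, ← integral_conj, mul_comm]
    rw [hconj, Complex.mul_conj, Complex.normSq_eq_norm_sq]
  have hintegral : ∫ x, (f x : ℂ) * f x = ((∫ x, f x ^ 2 : ℝ) : ℂ) := by
    simp [← integral_complex_ofReal, sq]
  simp only [Function.comp_apply, hterm, hintegral] at hsum
  exact_mod_cast hsum

/-! ### The reproducing kernel -/

lemma weight₁_pos (α : ℕ) {a : ℝ} (ha : 0 < a) (h : ℤ) : 0 < weight₁ α a h := by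
  unfold weight₁
  split_ifs with hh
  · positivity
  · have := Real.pi_pos
    positivity

lemma weight_pos {d : ℕ} (α : ℕ) {a : ℝ} (ha : 0 < a) (h : Fin d → ℤ) : 0 < weight α a h :=
  Finset.prod_pos fun j _ => weight₁_pos α ha (h j)

lemma weight_neg {d : ℕ} (α : ℕ) (a : ℝ) (h : Fin d → ℤ) : weight α a (-h) = weight α a h := by
  simp [weight, weight₁, neg_div]

lemma summable_pi_prod {β : Type*} {d : ℕ} {f : β → ℝ} (hf : ∀ b, 0 ≤ f b) (hfs : Summable f) :
    Summable fun x : Fin d → β => ∏ j, f (x j) := by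
  have htop : ∑' x : Fin d → β, ENNReal.ofReal (∏ j, f (x j)) ≠ ∞ := by
    simp only [ENNReal.ofReal_prod_of_nonneg fun _ _ => hf _]
    rw [tsum_pi_prod fun _ b => ENNReal.ofReal (f b)]
    exact ENNReal.prod_ne_top fun _ _ => hfs.tsum_ofReal_ne_top
  exact (ENNReal.summable_toReal htop).congr fun x =>
    ENNReal.toReal_ofReal (Finset.prod_nonneg fun _ _ => hf _)

lemma summable_inv_weight₁_sq {α : ℕ} (hα : 1 ≤ α) (a : ℝ) :
    Summable fun h : ℤ => (weight₁ α a h ^ 2)⁻¹ := by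
  have hpow : Summable fun h : ℤ => (|Real.pi / a| ^ (2 * α))⁻¹ * (1 / (h : ℝ) ^ (2 * α)) :=
    (Real.summable_one_div_int_pow.2 (by lia)).mul_left _
  refine (summable_congr_cofinite ?_).1 hpow
  filter_upwards [(Set.finite_singleton (0 : ℤ)).compl_mem_cofinite] with h hh
  rw [weight₁, if_neg (Set.mem_compl_singleton_iff.1 hh), ← pow_mul, mul_comm α,
    mul_div_right_comm, abs_mul, mul_pow, mul_inv, one_div, pow_mul |(h : ℝ)|, sq_abs,
    pow_mul (h : ℝ)]

lemma summable_inv_weight_sq {α : ℕ} (hα : 1 ≤ α) (d : ℕ) (a : ℝ) :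
    Summable fun h : Fin d → ℤ => (weight α a h ^ 2)⁻¹ := by
  simp only [weight, ← Finset.prod_pow, ← Finset.prod_inv_distrib]
  exact summable_pi_prod (f := fun h => (weight₁ α a h ^ 2)⁻¹) (fun _ => by positivity)
    (summable_inv_weight₁_sq hα a)

lemma trigProd_neg {d : ℕ} (a : ℝ) (h : Fin d → ℤ) (x : Box a d) :
    trigProd a (-h) x = conj (trigProd a h x) := by
  simp only [trigProd, trig, map_prod, map_mul, Complex.conj_ofReal, ← Complex.exp_conj,
    Complex.conj_I]
  refine Finset.prod_congr rfl fun j _ => ?_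
  congr 2
  push_cast [Pi.neg_apply]
  ring

lemma hasSum_kernel {d α : ℕ} (hα : 1 ≤ α) {a : ℝ} (x y : Box a d) :
    HasSum (fun h => (((weight α a h ^ 2)⁻¹ : ℝ) : ℂ) * conj (trigProd a h x) * trigProd a h y)
      (kernel α a x y : ℂ) := by
  let t (h : Fin d → ℤ) : ℂ :=
    (((weight α a h ^ 2)⁻¹ : ℝ) : ℂ) * trigProd a h x * conj (trigProd a h y)
  have hsum : HasSum t (∑' h, t h) := by
    refine (Summable.of_norm ?_).hasSum
    simp only [t, norm_mul, RCLike.norm_conj, norm_trigProd, Complex.norm_real]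
    exact ((summable_inv_weight_sq hα d a).norm.mul_right _).mul_right _
  have hneg (h : Fin d → ℤ) : t (-h) = conj (t h) := by
    simp only [t, trigProd_neg, weight_neg, map_mul, Complex.conj_ofReal]
  have hsum_conj : HasSum (fun h => conj (t h)) (∑' h, t h) := by
    simpa only [Function.comp_def, Equiv.neg_apply, hneg] using
      (Equiv.neg (Fin d → ℤ)).hasSum_iff.2 hsum
  have hreal : conj (∑' h, t h) = ∑' h, t h :=
    (hsum.map (starRingEnd ℂ) Complex.continuous_conj).unique hsum_conj
  have hkernel : (kernel α a x y : ℂ) = ∑' h, t h := Complex.conj_eq_iff_re.1 hreal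
  simpa only [hkernel, t, map_mul, Complex.conj_ofReal, Complex.conj_conj] using hsum_conj

lemma coeff_kernel {d α : ℕ} (hα : 1 ≤ α) {a : ℝ} (ha : 0 < a) (x : Box a d) (h : Fin d → ℤ) :
    coeff (kernel α a x) h = (((weight α a h ^ 2)⁻¹ : ℝ) : ℂ) * conj (trigProd a h x) := by
  refine coeff_eq_of_hasSum ha
    (c := fun h => (((weight α a h ^ 2)⁻¹ : ℝ) : ℂ) * conj (trigProd a h x)) ?_
    (hasSum_kernel hα x) h
  simp only [norm_mul, RCLike.norm_conj, norm_trigProd, Complex.norm_real]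
  exact (summable_inv_weight_sq hα d a).norm.mul_right _

lemma kernel_mem_korobovSubmodule {d α : ℕ} (hα : 1 ≤ α) {a : ℝ} (ha : 0 < a) (x : Box a d) :
    kernel α a x ∈ korobovSubmodule α a d := by
  refine ⟨fun y => ?_, ?_⟩
  · simpa only [coeff_kernel hα ha] using hasSum_kernel hα x y
  · simp only [coeff_kernel hα ha, norm_mul, RCLike.norm_conj, norm_trigProd, Complex.norm_real]
    refine ((summable_inv_weight_sq hα d a).mul_right
      (((1 / Real.sqrt (2 * a)) ^ d) ^ 2)).congr fun h => ?_
    have := weight_pos α ha h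
    rw [Real.norm_of_nonneg (by positivity)]
    field_simp

/-- The kernel section `K(x, ·)` as an element of the Korobov space. -/
def kernelSection {d α : ℕ} (hα : 1 ≤ α) {a : ℝ} (ha : 0 < a) (x : Box a d) :
    KorobovSpace α a d := ⟨kernel α a x, kernel_mem_korobovSubmodule hα ha x⟩

lemma toFun_kernelSection {d α : ℕ} (hα : 1 ≤ α) {a : ℝ} (ha : 0 < a) (x : Box a d) :
    toFun (kernelSection hα ha x) = kernel α a x := rfl

lemma inner_kernelSection {d α : ℕ} (hα : 1 ≤ α) {a : ℝ} (ha : 0 < a)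
    (f : KorobovSpace α a d) (x : Box a d) :
    inner ℝ f (kernelSection hα ha x) = f x := by
  change (∑' h, _ : ℂ).re = _
  have hf : HasSum (fun h => coeff f h * trigProd a h x) ((f x : ℝ) : ℂ) := f.2.1 x
  rw [← Complex.ofReal_re (f x), ← hf.tsum_eq]
  congr 2
  funext h
  have hw : (weight α a h : ℂ) ≠ 0 := by exact_mod_cast (weight_pos α ha h).ne'
  rw [toFun_kernelSection, coeff_kernel hα ha, map_mul, Complex.conj_conj, Complex.conj_ofReal]
  push_cast
  field_simp

lemma kernelSpan_eq_span {ι : Type*} {d α : ℕ} (hα : 1 ≤ α) {a : ℝ} (ha : 0 < a)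
    (X : ι → Box a d) :
    kernelSpan α X = Submodule.span ℝ (Set.range fun k => kernelSection hα ha (X k)) := by
  have hrange : Set.range (fun k => kernel α a (X k)) =
      toFun '' Set.range fun k => kernelSection hα ha (X k) := by
    rw [← Set.range_comp]
    rfl
  rw [kernelSpan, hrange, ← Submodule.map_span,
    Submodule.comap_map_eq_of_injective toFun_injective]

lemma mem_orthogonal_kernelSpan {ι : Type*} {d α : ℕ} (hα : 1 ≤ α) {a : ℝ} (ha : 0 < a)
    (X : ι → Box a d) (f : KorobovSpace α a d) :
    f ∈ (kernelSpan α X)ᗮ ↔ ∀ k, f (X k) = 0 := by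
  rw [kernelSpan_eq_span hα ha, ← Submodule.span_singleton_le_iff_mem,
    ← Submodule.isOrtho_iff_le, Submodule.isOrtho_span]
  simp only [Set.mem_singleton_iff, forall_eq, Set.forall_mem_range, inner_kernelSection]

lemma interpolates_iff_eq_proj {ι : Type*} [Finite ι] {d α : ℕ} (hα : 1 ≤ α) {a : ℝ}
    (ha : 0 < a) (X : ι → Box a d) (φ : KorobovSpace α a d) {v : KorobovSpace α a d}
    (hv : v ∈ kernelSpan α X) : (∀ k, v (X k) = φ (X k)) ↔ v = proj α X φ := by
  have horth : φ - v ∈ (kernelSpan α X)ᗮ ↔ ∀ k, v (X k) = φ (X k) := by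
    simp only [mem_orthogonal_kernelSpan hα ha, map_sub, Pi.sub_apply, sub_eq_zero]
    exact forall_congr' fun k => eq_comm
  rw [← horth]
  constructor
  · exact fun h => (Submodule.eq_starProjection_of_mem_orthogonal hv h).symm
  · rintro rfl
    exact Submodule.sub_starProjection_mem_orthogonal φ

lemma norm_sub_proj_le {ι : Type*} [Finite ι] {d α : ℕ} {a : ℝ}
    (X : ι → Box a d) (φ : KorobovSpace α a d) : ‖φ - proj α X φ‖ ≤ ‖φ‖ := by
  rw [proj, ← Submodule.starProjection_orthogonal_val]
  exact Submodule.norm_starProjection_apply_le _ φ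

/-! ### Aliasing on the lattice -/

lemma trig_mul_conj_lattice {a : ℝ} (ha : 0 < a) (h k : ℤ) (t : ℝ) :
    trig a h (2 * a * Int.fract t - a) * conj (trig a k (2 * a * Int.fract t - a)) =
      ((1 / (2 * a) : ℝ) : ℂ) * Complex.exp (2 * Real.pi * Complex.I * ((h - k : ℤ) * t)) := by
  have hfract : (2 * a * Int.fract t - a + a) / (2 * a) = t - ⌊t⌋ := by
    rw [sub_add_cancel, mul_div_cancel_left₀ _ (by positivity), Int.fract]
  rw [trig_mul_conj ha.le, hfract]
  congr 1
  refine Complex.exp_eq_exp_iff_exists_int.2 ⟨-((h - k) * ⌊t⌋), ?_⟩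
  push_cast
  ring

lemma trigProd_mul_conj_lattice {d N : ℕ} {a : ℝ} (ha : 0 < a) (z : Fin d → ℕ) (k : Fin N)
    (h l : Fin d → ℤ) :
    trigProd a (h + l) (scaledLattice a ha.le N z k) *
        conj (trigProd a h (scaledLattice a ha.le N z k)) =
      ((1 / (2 * a) : ℝ) : ℂ) ^ d *
        (Complex.exp (2 * Real.pi * Complex.I / N) ^ ∑ j, l j * (z j : ℤ)) ^ ((k : ℕ) + 1) := by
  simp only [trigProd, map_prod, scaledLattice, ← Finset.prod_mul_distrib,
    trig_mul_conj_lattice ha, Pi.add_apply, add_sub_cancel_left]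
  rw [Finset.prod_mul_distrib, Finset.prod_const, Finset.card_univ, Fintype.card_fin,
    ← Complex.exp_sum, ← Complex.exp_int_mul, ← Complex.exp_nat_mul]
  congr 2
  push_cast
  rw [Finset.sum_mul, Finset.mul_sum]
  exact Finset.sum_congr rfl fun j _ => by ring

lemma sum_zpow_exp_pow_succ {N : ℕ} (hN : N ≠ 0) (m : ℤ) :
    ∑ k : Fin N, (Complex.exp (2 * Real.pi * Complex.I / N) ^ m) ^ ((k : ℕ) + 1) =
      if (N : ℤ) ∣ m then (N : ℂ) else 0 := by
  have hprim := Complex.isPrimitiveRoot_exp N hN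
  set η := Complex.exp (2 * Real.pi * Complex.I / N) ^ m with hη
  have hη1 : η = 1 ↔ (N : ℤ) ∣ m := hprim.zpow_eq_one_iff_dvd m
  split_ifs with hm
  · simp [hη1.2 hm]
  · have hηN : η ^ N = 1 := by
      rw [hη, ← zpow_natCast, zpow_comm, zpow_natCast, hprim.pow_eq_one, one_zpow]
    rw [Fin.sum_univ_eq_sum_range fun k => η ^ (k + 1)]
    simp only [pow_succ]
    rw [← Finset.sum_mul, geom_sum_eq (mt hη1.1 hm), hηN, sub_self, zero_div, zero_mul]

lemma sum_trigProd_mul_conj_lattice {d N : ℕ} (hN : N ≠ 0) {a : ℝ} (ha : 0 < a)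
    (z : Fin d → ℕ) (h l : Fin d → ℤ) :
    ∑ k, trigProd a (h + l) (scaledLattice a ha.le N z k) *
        conj (trigProd a h (scaledLattice a ha.le N z k)) =
      (dualLattice N z : Set (Fin d → ℤ)).indicator (fun _ => ((1 / (2 * a) : ℝ) : ℂ) ^ d * N)
        l := by
  classical
  simp only [trigProd_mul_conj_lattice ha, ← Finset.mul_sum, sum_zpow_exp_pow_succ hN,
    Set.indicator_apply, SetLike.mem_coe, mem_dualLattice, mul_ite, mul_zero]

lemma hasSum_coeff_dualLattice {d N : ℕ} (hN : N ≠ 0) {a : ℝ} (ha : 0 < a) {z : Fin d → ℕ}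
    {g : Box a d → ℝ} (hg : HasFourierSeries g)
    (hg0 : ∀ k, g (scaledLattice a ha.le N z k) = 0) (h : Fin d → ℤ) :
    HasSum ((dualLattice N z : Set (Fin d → ℤ)).indicator fun l => coeff g (h + l)) 0 := by
  let x : Fin N → Box a d := scaledLattice a ha.le N z
  have hx (k : Fin N) : HasSum
      (fun l => coeff g (h + l) * (trigProd a (h + l) (x k) * conj (trigProd a h (x k)))) 0 := by
    have hs := ((Equiv.addLeft h).hasSum_iff.2 (hg (x k))).mul_right (conj (trigProd a h (x k)))
    rw [hg0 k, Complex.ofReal_zero, zero_mul] at hs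
    simpa only [Function.comp_apply, Equiv.coe_addLeft, mul_assoc] using hs
  have hsum := hasSum_sum fun k (_ : k ∈ Finset.univ) => hx k
  simp only [← Finset.mul_sum, x, sum_trigProd_mul_conj_lattice hN ha, Finset.sum_const_zero]
    at hsum
  set c : ℂ := ((1 / (2 * a) : ℝ) : ℂ) ^ d * N
  have hc : c ≠ 0 :=
    mul_ne_zero (pow_ne_zero _ (Complex.ofReal_ne_zero.2 (by positivity))) (Nat.cast_ne_zero.2 hN)
  rw [← zero_mul c⁻¹]
  refine (hsum.mul_right c⁻¹).congr_fun fun l => ?_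
  by_cases hl : l ∈ dualLattice N z <;> simp [hl, hc]

lemma enorm_coeff_le_tsum_dualLattice {d N : ℕ} (hN : N ≠ 0) {a : ℝ} (ha : 0 < a) {z : Fin d → ℕ}
    {g : Box a d → ℝ} (hg : HasFourierSeries g)
    (hg0 : ∀ k, g (scaledLattice a ha.le N z k) = 0) (h : Fin d → ℤ) :
    ‖coeff g h‖ₑ ≤
      ∑' l : ↥((dualLattice N z : Set (Fin d → ℤ)) \ {0}), ‖coeff g (h + l.1)‖ₑ := by
  classical
  let F := (dualLattice N z : Set (Fin d → ℤ)).indicator fun l => coeff g (h + l)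
  have hF : HasSum F 0 := hasSum_coeff_dualLattice hN ha hg hg0 h
  have hF0 : F 0 = coeff g h := by simp [F, (dualLattice N z).zero_mem]
  have hsplit : coeff g h = -∑' l, if l = 0 then 0 else F l := by
    rw [eq_neg_iff_add_eq_zero, ← hF0, ← hF.summable.tsum_eq_add_tsum_ite, hF.tsum_eq]
  rw [hsplit, enorm_neg, tsum_subtype _ fun l => ‖coeff g (h + l)‖ₑ]
  refine enorm_tsum_le_tsum_enorm.trans_eq (tsum_congr fun l => ?_)
  by_cases hl : l = 0 <;> by_cases hl' : l ∈ dualLattice N z <;> simp [F, hl, hl']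

/-! ### The error bound -/

lemma eLpNorm_two_sq {d : ℕ} {a : ℝ} (ha : 0 < a) {g : Box a d → ℝ} (hg : HasFourierSeries g) :
    eLpNorm g 2 volume ^ 2 = ∑' h, ‖coeff g h‖ₑ ^ 2 := by
  have hs := hasSum_norm_sq_coeff ha hg
  have hm : MemLp g 2 (volume : Measure (Box a d)) :=
    (memLp_two_iff_integrable_sq hg.continuous.aestronglyMeasurable).2
      ((hg.continuous.pow 2).integrable_of_hasCompactSupport (.of_compactSpace _))
  calc eLpNorm g 2 volume ^ 2 = ENNReal.ofReal (∫ x, g x ^ 2) := by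
        rw [hm.eLpNorm_eq_integral_rpow_norm two_ne_zero ENNReal.ofNat_ne_top,
          ← ENNReal.ofReal_pow (by positivity)]
        simp only [ENNReal.toReal_ofNat, Real.rpow_two, Real.norm_eq_abs, sq_abs]
        rw [← Real.rpow_mul_natCast (integral_nonneg fun x => sq_nonneg (g x))]
        simp
    _ = ∑' h, ‖coeff g h‖ₑ ^ 2 := by
        rw [← hs.tsum_eq, ENNReal.ofReal_tsum_of_nonneg (fun _ => by positivity) hs.summable]
        simp only [ENNReal.ofReal_pow (norm_nonneg _), ofReal_norm]

lemma weight₁_half_le (α : ℕ) {a : ℝ} (ha : 1 / 2 ≤ a) (h : ℤ) :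
    weight₁ α (1 / 2) h ≤ (2 * a) ^ α * weight₁ α a h := by
  unfold weight₁
  split_ifs
  · rw [mul_one_div_cancel two_ne_zero, Real.sqrt_one]
    exact one_le_mul_of_one_le_of_one_le (one_le_pow₀ (by linarith))
      (Real.one_le_sqrt.2 (by linarith))
  · have : 0 < a := by linarith
    rw [← mul_pow, ← abs_of_pos (by positivity : 0 < 2 * a), ← abs_mul]
    refine le_of_eq ?_
    congr 2
    field_simp

lemma weight_half_le {d : ℕ} (α : ℕ) {a : ℝ} (ha : 1 / 2 ≤ a) (h : Fin d → ℤ) :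
    weight α (1 / 2) h ≤ (2 * a) ^ (α * d) * weight α a h := by
  calc weight α (1 / 2) h ≤ ∏ j, (2 * a) ^ α * weight₁ α a (h j) :=
        Finset.prod_le_prod (fun j _ => (weight₁_pos α one_half_pos (h j)).le)
          fun j _ => weight₁_half_le α ha (h j)
    _ = (2 * a) ^ (α * d) * weight α a h := by
        rw [Finset.prod_mul_distrib, Finset.prod_const, Finset.card_univ, Fintype.card_fin, pow_mul,
          weight]

lemma inv_decayProd_two_mul {d : ℕ} (α : ℕ) (h : Fin d → ℤ) :
    (decayProd (2 * α) h)⁻¹ = ENNReal.ofReal (weight α (1 / 2) h ^ 2) := by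
  have hpos : 0 < weight α (1 / 2) h ^ 2 := pow_pos (weight_pos α one_half_pos h) 2
  rw [← ofReal_inv_weight_half_sq, ENNReal.ofReal_inv_of_pos hpos, inv_inv]

lemma tsum_enorm_coeff_sq_div_le {d α : ℕ} {a : ℝ} (ha : 1 / 2 ≤ a) (g : KorobovSpace α a d) :
    ∑' h, ‖coeff g h‖ₑ ^ 2 / decayProd (2 * α) h ≤
      ENNReal.ofReal ((2 * a) ^ (α * d) * ‖g‖) ^ 2 := by
  have : 0 ≤ 2 * a := by linarith
  have hs : Summable fun h => ‖coeff g h‖ ^ 2 * weight α a h ^ 2 := g.2.2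
  have hnorm : ‖g‖ ^ 2 = ∑' h, ‖coeff g h‖ ^ 2 * weight α a h ^ 2 := by
    rw [← innerK_self, ← real_inner_self_eq_norm_sq]
    rfl
  have hterm (h : Fin d → ℤ) : ‖coeff g h‖ₑ ^ 2 / decayProd (2 * α) h ≤
      ENNReal.ofReal (((2 * a) ^ (α * d)) ^ 2) *
        ENNReal.ofReal (‖coeff g h‖ ^ 2 * weight α a h ^ 2) := by
    rw [div_eq_mul_inv, inv_decayProd_two_mul, ← ofReal_norm,
      ← ENNReal.ofReal_pow (norm_nonneg _), ← ENNReal.ofReal_mul (by positivity),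
      ← ENNReal.ofReal_mul (by positivity), mul_left_comm, ← mul_pow ((2 * a) ^ (α * d))]
    gcongr
    exacts [(weight_pos α one_half_pos h).le, weight_half_le α ha h]
  calc ∑' h, ‖coeff g h‖ₑ ^ 2 / decayProd (2 * α) h
      ≤ ∑' h, ENNReal.ofReal (((2 * a) ^ (α * d)) ^ 2) *
          ENNReal.ofReal (‖coeff g h‖ ^ 2 * weight α a h ^ 2) := ENNReal.tsum_le_tsum hterm
    _ = ENNReal.ofReal ((2 * a) ^ (α * d) * ‖g‖) ^ 2 := by
        rw [ENNReal.tsum_mul_left, ← ENNReal.ofReal_tsum_of_nonneg (fun _ => by positivity) hs,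
          ← hnorm, ← ENNReal.ofReal_mul (by positivity), ← mul_pow,
          ENNReal.ofReal_pow (by positivity)]

lemma decayProd_two_mul_ne_zero {d : ℕ} (α : ℕ) (h : Fin d → ℤ) : decayProd (2 * α) h ≠ 0 := by
  rw [← ENNReal.inv_ne_top, inv_decayProd_two_mul]
  exact ENNReal.ofReal_ne_top

lemma decayProd_two_mul_ne_top {d : ℕ} (α : ℕ) (h : Fin d → ℤ) : decayProd (2 * α) h ≠ ∞ :=
  ofReal_inv_weight_half_sq α h ▸ ENNReal.ofReal_ne_top

lemma eLpNorm_le_mul_rpow_cbcSum {d α N : ℕ} (hN : N ≠ 0) {z : Fin d → ℕ} {a : ℝ}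
    (ha0 : 0 < a) (ha : 1 / 2 ≤ a) {g : KorobovSpace α a d}
    (hg0 : ∀ k, g (scaledLattice a ha0.le N z k) = 0) :
    eLpNorm g 2 volume ≤
      ENNReal.ofReal ((2 * a) ^ (α * d) * ‖g‖) * cbcSum α N z ^ (1 / 4 : ℝ) := by
  set M := ENNReal.ofReal ((2 * a) ^ (α * d) * ‖g‖)
  have hg : HasFourierSeries g := g.2.1
  have hfour : eLpNorm g 2 volume ^ 4 ≤ (M * cbcSum α N z ^ (1 / 4 : ℝ)) ^ 4 := by
    calc eLpNorm g 2 volume ^ 4 = (∑' h, ‖coeff g h‖ₑ ^ 2) ^ 2 := by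
          rw [← eLpNorm_two_sq ha0 hg, ← pow_mul]
      _ ≤ (∑' h, ‖coeff g h‖ₑ ^ 2 / decayProd (2 * α) h) ^ 2 * cbcSum α N z :=
          sq_tsum_sq_le_mul_tsum_autocorr (decayProd_two_mul_ne_zero α)
            (decayProd_two_mul_ne_top α) (enorm_coeff_le_tsum_dualLattice hN ha0 hg hg0)
      _ ≤ (M ^ 2) ^ 2 * cbcSum α N z := by
          gcongr
          exact tsum_enorm_coeff_sq_div_le ha g
      _ = (M * cbcSum α N z ^ (1 / 4 : ℝ)) ^ 4 := by
          rw [mul_pow, ← pow_mul, ← ENNReal.rpow_mul_natCast]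
          norm_num
  exact (ENNReal.pow_right_strictMono four_ne_zero).le_iff_le.1 hfour

/-! ### The constant -/

lemma four_add_two_rpow_le {b : ℝ} (hb : 1 ≤ b) :
    4 + (2 : ℝ) ^ (b + 1) ≤ 5 / 2 + (2 : ℝ) ^ (2 * b + 1) := by
  have hfour : (2 : ℝ) ^ (2 : ℝ) ≤ 2 ^ (b + 1) :=
    Real.rpow_le_rpow_of_exponent_le one_le_two (by linarith)
  have hsq : (2 : ℝ) ^ (2 * b + 1) = ((2 : ℝ) ^ (b + 1)) ^ 2 / 2 := by
    rw [eq_div_iff two_ne_zero, ← Real.rpow_add_one two_ne_zero,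
      ← Real.rpow_mul_natCast zero_le_two]
    congr 1
    push_cast
    ring
  norm_num at hfour
  nlinarith

lemma subsetSum_ofReal (d : ℕ) {w : ℝ} (hw : 0 ≤ w) :
    subsetSum d (ENNReal.ofReal w) =
      ENNReal.ofReal (∑ u : Finset (Fin d), ((max u.card 1 : ℕ) : ℝ) * w ^ u.card) := by
  rw [subsetSum, ENNReal.ofReal_sum_of_nonneg fun _ _ => by positivity]
  refine Finset.sum_congr rfl fun u _ => ?_
  rw [ENNReal.ofReal_mul (Nat.cast_nonneg _), ENNReal.ofReal_natCast, ENNReal.ofReal_pow hw]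

lemma zeta_nonneg (s : ℝ) : 0 ≤ zeta s := tsum_nonneg fun _ => by positivity

lemma errorConst_nonneg (α : ℕ) (δ : ℝ) (d : ℕ) : 0 ≤ errorConst α δ d := by
  have := zeta_nonneg (α / (α - 2 * δ))
  unfold errorConst kappa
  positivity

lemma ofReal_errorConst {α : ℕ} {δ : ℝ} (hδ : 0 < δ) (hδα : δ < α / 2) (d : ℕ) :
    ENNReal.ofReal (errorConst α δ d) = ENNReal.ofReal (kappa α δ) *
      subsetSum d (nonzeroMass (α / (α - 2 * δ))) ^ ((α : ℝ) - 2 * δ) := by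
  have hexp : 0 < (α : ℝ) - 2 * δ := by linarith
  have hw : 0 ≤ 2 * (1 / (2 * Real.pi)) ^ ((α : ℝ) / (α - 2 * δ)) * zeta (α / (α - 2 * δ)) := by
    have := zeta_nonneg (α / (α - 2 * δ))
    positivity
  rw [nonzeroMass_eq ((one_lt_div hexp).2 (by linarith)), subsetSum_ofReal d hw, errorConst,
    ENNReal.ofReal_mul (by unfold kappa; positivity),
    ENNReal.ofReal_rpow_of_nonneg (by positivity) hexp.le]

lemma IsCBCVector.rpow_cbcSum_le {d α N : ℕ} (hα : 1 ≤ α) (hN : N.Prime) {z : Fin d → ℕ}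
    (hz : IsCBCVector α N z) {p : ℝ} (hp : 1 / 2 ≤ p) (hpα : p ≤ α) :
    cbcSum α N z ^ (1 / (2 * p)) ≤
      ENNReal.ofReal (max 6 (5 / 2 + 2 ^ (2 * α / p + 1))) *
        subsetSum d (nonzeroMass (α / p)) ^ 2 / N := by
  have hb : 2 * α * (1 / (2 * p)) = α / p := by field_simp
  have hb1 : 1 ≤ α / p := (one_le_div (by linarith)).2 hpα
  have hK : (4 + 2 ^ (α / p + 1) : ℝ≥0∞) ≤
      ENNReal.ofReal (max 6 (5 / 2 + 2 ^ (2 * α / p + 1))) := by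
    have htwo : (2 : ℝ≥0∞) ^ (α / p + 1) = ENNReal.ofReal (2 ^ (α / p + 1)) := by
      rw [← ENNReal.ofReal_rpow_of_pos two_pos, ENNReal.ofReal_ofNat]
    rw [htwo, ← ENNReal.ofReal_ofNat 4, ← ENNReal.ofReal_add (by norm_num) (by positivity),
      mul_div_assoc]
    exact ENNReal.ofReal_le_ofReal (le_max_of_le_right (four_add_two_rpow_le hb1))
  have hcbc := hz.natCast_mul_rpow_cbcSum_le hα hN (q := 1 / (2 * p)) (hb ▸ hb1)
    ((div_le_one (by linarith)).2 (by linarith))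
  rw [hb] at hcbc
  rw [ENNReal.le_div_iff_mul_le (.inl (Nat.cast_ne_zero.2 hN.ne_zero))
    (.inl (ENNReal.natCast_ne_top N)), mul_comm]
  exact hcbc.trans (by gcongr)

lemma IsCBCVector.rpow_quarter_cbcSum_le {d α N : ℕ} (hα : 1 ≤ α) (hN : N.Prime)
    {z : Fin d → ℕ} (hz : IsCBCVector α N z) {δ : ℝ} (hδ : 0 < δ) (hδα : δ ≤ α / 2 - 1 / 4) :
    cbcSum α N z ^ (1 / 4 : ℝ) ≤
      ENNReal.ofReal (errorConst α δ d) * ENNReal.ofReal ((N : ℝ) ^ (-((α : ℝ) / 2 - δ))) := by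
  have hκ : 0 < (α : ℝ) / 2 - δ := by linarith
  have hp : (α : ℝ) - 2 * δ = 2 * (α / 2 - δ) := by ring
  have hquarter : 1 / (2 * ((α : ℝ) - 2 * δ)) * (α / 2 - δ) = 1 / 4 := by
    rw [one_div_mul_eq_div, div_eq_div_iff (ne_of_gt (by linarith)) four_ne_zero]
    ring
  set K : ℝ := max 6 (5 / 2 + 2 ^ (2 * α / ((α : ℝ) - 2 * δ) + 1))
  set Q := subsetSum d (nonzeroMass (α / (α - 2 * δ)))
  have hkappa : ENNReal.ofReal K ^ ((α : ℝ) / 2 - δ) ≤ ENNReal.ofReal (kappa α δ) := by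
    rw [ENNReal.ofReal_rpow_of_nonneg (by positivity) hκ.le]
    exact ENNReal.ofReal_le_ofReal
      (le_mul_of_one_le_left (by positivity) (Real.one_le_sqrt.2 one_le_two))
  have hN0 : (0 : ℝ) < N := Nat.cast_pos.2 hN.pos
  calc cbcSum α N z ^ (1 / 4 : ℝ)
      = (cbcSum α N z ^ (1 / (2 * ((α : ℝ) - 2 * δ)))) ^ ((α : ℝ) / 2 - δ) := by
        rw [← ENNReal.rpow_mul, hquarter]
    _ ≤ (ENNReal.ofReal K * Q ^ 2 / N) ^ ((α : ℝ) / 2 - δ) := by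
        gcongr
        exact hz.rpow_cbcSum_le hα hN (by linarith) (by linarith)
    _ = ENNReal.ofReal K ^ ((α : ℝ) / 2 - δ) * Q ^ ((α : ℝ) - 2 * δ) *
          ENNReal.ofReal ((N : ℝ) ^ (-((α : ℝ) / 2 - δ))) := by
        rw [ENNReal.div_rpow_of_nonneg _ _ hκ.le, ENNReal.mul_rpow_of_nonneg _ _ hκ.le,
          ← ENNReal.rpow_natCast_mul, ← ENNReal.ofReal_rpow_of_pos hN0, ENNReal.ofReal_natCast,
          ENNReal.rpow_neg, hp, div_eq_mul_inv, Nat.cast_ofNat]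
    _ ≤ ENNReal.ofReal (errorConst α δ d) * ENNReal.ofReal ((N : ℝ) ^ (-((α : ℝ) / 2 - δ))) := by
        rw [ofReal_errorConst hδ (by linarith)]
        gcongr

lemma IsCBCVector.eLpNorm_le {d α N : ℕ} (hα : 1 ≤ α) (hN : N.Prime) {z : Fin d → ℕ}
    (hz : IsCBCVector α N z) {a : ℝ} (ha0 : 0 < a) (ha : 1 / 2 ≤ a) {g : KorobovSpace α a d}
    (hg0 : ∀ k, g (scaledLattice a ha0.le N z k) = 0) {δ : ℝ} (hδ : 0 < δ)
    (hδα : δ ≤ α / 2 - 1 / 4) :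
    eLpNorm g 2 volume ≤ ENNReal.ofReal (errorConst α δ d * ‖g‖ * (2 * a) ^ (α * d) *
      (N : ℝ) ^ (-((α : ℝ) / 2 - δ))) := by
  have hC := errorConst_nonneg α δ d
  calc eLpNorm g 2 volume
      ≤ ENNReal.ofReal ((2 * a) ^ (α * d) * ‖g‖) * cbcSum α N z ^ (1 / 4 : ℝ) :=
        eLpNorm_le_mul_rpow_cbcSum hN.ne_zero ha0 ha hg0
    _ ≤ ENNReal.ofReal ((2 * a) ^ (α * d) * ‖g‖) * (ENNReal.ofReal (errorConst α δ d) *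
          ENNReal.ofReal ((N : ℝ) ^ (-((α : ℝ) / 2 - δ)))) := by
        gcongr
        exact hz.rpow_quarter_cbcSum_le hα hN hδ hδα
    _ = _ := by
        rw [← ENNReal.ofReal_mul hC, ← ENNReal.ofReal_mul (by positivity)]
        congr 1
        ring

end Korobov

end

theorem proposition3p5 (α d N : ℕ) (hα : 1 ≤ α) (hd : 1 ≤ d) (hN : N.Prime) :
    (∃ z : Fin d → ℕ, Korobov.IsCBCVector α N z) ∧
    ∀ z : Fin d → ℕ, Korobov.IsCBCVector α N z →
      ∀ (a : ℝ) (ha : 1 / 2 ≤ a) (φ : Korobov.KorobovSpace α a d),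
        -- the projection is the unique kernel interpolant of `φ` at the scaled lattice points
        (∀ v ∈ Korobov.kernelSpan α (Korobov.scaledLattice a (by linarith) N z),
          (∀ k, v (Korobov.scaledLattice a (by linarith) N z k) =
            φ (Korobov.scaledLattice a (by linarith) N z k)) ↔
          v = Korobov.proj α (Korobov.scaledLattice a (by linarith) N z) φ) ∧
        -- the error bound
        ∀ δ : ℝ, 0 < δ → δ < (α : ℝ) / 2 →
          MeasureTheory.eLpNorm
              (fun x => Korobov.proj α (Korobov.scaledLattice a (by linarith) N z) φ x - φ x)
              2 MeasureTheory.volume ≤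
            ENNReal.ofReal
              (Korobov.errorConst α (min δ ((α : ℝ) / 2 - 1 / 4)) d * ‖φ‖ *
                (2 * a) ^ (α * d) * (N : ℝ) ^ (-((α : ℝ) / 2 - δ))) := by
  refine ⟨Korobov.exists_isCBCVector hN.two_le α d, fun z hz a ha φ => ?_⟩
  have ha0 : 0 < a := by linarith
  set X := Korobov.scaledLattice a ha0.le N z
  refine ⟨fun v hv => Korobov.interpolates_iff_eq_proj hα ha0 X φ hv, fun δ hδ _ => ?_⟩
  have hα' : (1 : ℝ) ≤ α := by exact_mod_cast hα
  have hN1 : (1 : ℝ) ≤ N := by exact_mod_cast hN.one_le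
  let g := φ - Korobov.proj α X φ
  have hg0 (k : Fin N) : g (X k) = 0 :=
    (Korobov.mem_orthogonal_kernelSpan hα ha0 X g).1
      ((Korobov.kernelSpan α X).sub_starProjection_mem_orthogonal φ) k
  have herror : (fun x => Korobov.proj α X φ x - φ x) = -Korobov.toFun g := by
    funext x
    simp [g]
  rw [herror, MeasureTheory.eLpNorm_neg]
  refine (hz.eLpNorm_le hα hN ha0 ha hg0 (lt_min hδ (by linarith)) (min_le_right _ _)).trans
    (ENNReal.ofReal_le_ofReal ?_)
  have hC := Korobov.errorConst_nonneg α (min δ ((α : ℝ) / 2 - 1 / 4)) d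
  gcongr
  · exact Korobov.norm_sub_proj_le X φ
  · exact min_le_left _ _
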